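/- \textbf{Theorem.} All graphs are finite and simple. The line graph $L(G)$ of a graph $G$ has the edges of $G$ as its vertices, two distinct edges being adjacent if they share an endpoint. An \emph{interval graph} is the intersection graph of a finite family of closed intervals of the real line, and an \emph{interval completion} of a graph $H$ is an interval graph on the vertex set of $H$ that contains $H$ as a subgraph. \emph{Interval Graph Completion} asks, for a given graph $H$, for an interval completion of $H$ with the minimum number of edges, and for that number. Interval Graph Completion can be solved in polynomial time for complements of line graphs. That is, there are an algorithm (a program for a random access machine with unit cost whose arithmetic operations are addition and truncated subtraction) and a polynomial $T$ with natural number coefficients such that for every $m\ge 0$ and every graph $H$ on $m$ vertices that is isomorphic to $\overline{L(G)}$ for some graph $G$, the algorithm, given $m$ and the adjacency matrix of $H$ (but not $G$), halts after at most $T(m)$ steps and outputs the adjacency matrix and the number of edges of an interval completion of $H$ that has the minimum number of edges among all interval completions of $H$. -/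

import Mathlib

/-- `G` is an interval graph: the intersection graph of a family of closed intervals of the
real line, one (nonempty) interval for each vertex. -/
def IsIntervalGraph {V : Type*} (G : SimpleGraph V) : Prop :=
  ∃ l r : V → ℝ, (∀ v, l v ≤ r v) ∧
    ∀ u v, G.Adj u v ↔ u ≠ v ∧ (Set.Icc (l u) (r u) ∩ Set.Icc (l v) (r v)).Nonempty

/-- `K` is an interval completion of `H`: an interval graph on the vertex set of `H` that
contains `H` as a subgraph. -/
def IsIntervalCompletion {V : Type*} (H K : SimpleGraph V) : Prop :=
  H ≤ K ∧ IsIntervalGraph K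

/-- `K` is an optimal solution of Interval Graph Completion on `H`: an interval completion of
`H` with the minimum number of edges. (Only used on finite vertex sets.) -/
def IsMinimumIntervalCompletion {V : Type*} (H K : SimpleGraph V) : Prop :=
  IsIntervalCompletion H K ∧
    ∀ K' : SimpleGraph V, IsIntervalCompletion H K' → K.edgeSet.ncard ≤ K'.edgeSet.ncard

/-- `H` is (isomorphic to) the complement of the line graph of a finite simple graph. -/
def IsCoLineGraph {V : Type*} (H : SimpleGraph V) : Prop :=
  ∃ (n : ℕ) (G : SimpleGraph (Fin n)), Nonempty (H ≃g G.lineGraphᶜ)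

namespace RandomAccess

/-- Configuration of the random access machine: registers `reg i`, and memory banks
`mem a`, each of them an array of natural numbers. -/
structure State where
  reg : ℕ → ℕ
  mem : ℕ → ℕ → ℕ

/-- Elementary instructions. The only arithmetic is addition and truncated subtraction, so a
run of `t` steps lengthens the binary numbers in the machine by at most `O(t)` bits, and unit
cost is polynomially equivalent to Turing machine time. -/
inductive Instr
  /-- `reg i := c` -/
  | const (i c : ℕ)
  /-- `reg i := reg j + reg k` -/
  | add (i j k : ℕ)
  /-- `reg i := reg j - reg k`, where the result is `0` if `reg j < reg k` -/
  | sub (i j k : ℕ)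
  /-- `reg i := mem a [reg j]` -/
  | load (i a j : ℕ)
  /-- `mem a [reg i] := reg j` -/
  | store (a i j : ℕ)

/-- The effect of an elementary instruction. -/
def Instr.apply : Instr → State → State
  | .const i c, s => { s with reg := Function.update s.reg i c }
  | .add i j k, s => { s with reg := Function.update s.reg i (s.reg j + s.reg k) }
  | .sub i j k, s => { s with reg := Function.update s.reg i (s.reg j - s.reg k) }
  | .load i a j, s => { s with reg := Function.update s.reg i (s.mem a (s.reg j)) }
  | .store a i j, s =>
      { s with mem := Function.update s.mem a (Function.update (s.mem a) (s.reg i) (s.reg j)) }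

/-- Programs: finite structured programs built from the elementary instructions. -/
inductive Program
  | skip
  | instr (c : Instr)
  | seq (p q : Program)
  /-- if `reg i ≠ 0` then `p` else `q` -/
  | cond (i : ℕ) (p q : Program)
  /-- as long as `reg i ≠ 0`, do `p` -/
  | loop (i : ℕ) (p : Program)

/-- `Run p s t s'`: started in configuration `s`, the program `p` halts after exactly `t` steps,
in configuration `s'`. Every instruction and every evaluation of a test is one step. -/
inductive Run : Program → State → ℕ → State → Prop
  | skip (s : State) : Run .skip s 1 s
  | instr (c : Instr) (s : State) : Run (.instr c) s 1 (c.apply s)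
  | seq {p q : Program} {s s' s'' : State} {t t' : ℕ} :
      Run p s t s' → Run q s' t' s'' → Run (.seq p q) s (t + t') s''
  | cond_true {i : ℕ} {p q : Program} {s s' : State} {t : ℕ} :
      s.reg i ≠ 0 → Run p s t s' → Run (.cond i p q) s (t + 1) s'
  | cond_false {i : ℕ} {p q : Program} {s s' : State} {t : ℕ} :
      s.reg i = 0 → Run q s t s' → Run (.cond i p q) s (t + 1) s'
  | loop_done {i : ℕ} {p : Program} {s : State} :
      s.reg i = 0 → Run (.loop i p) s 1 s
  | loop_step {i : ℕ} {p : Program} {s s' s'' : State} {t t' : ℕ} :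
      s.reg i ≠ 0 → Run p s t s' → Run (.loop i p) s' t' s'' →
        Run (.loop i p) s (t + t' + 1) s''

open Classical in
/-- The initial configuration on a graph with vertices `0, …, m - 1`: the number `m` is in
register `0`, the adjacency matrix is in bank `0` (row by row), and all else is `0`. -/
noncomputable def inputGraph {m : ℕ} (H : SimpleGraph (Fin m)) : State where
  reg i := if i = 0 then m else 0
  mem a x := if a = 0 ∧ ∃ i j : Fin m, x = i.val * m + j.val ∧ H.Adj i j then 1 else 0

open Classical in
/-- The final configuration `s` holds the graph `K` as output: its number of edges is in
register `1` and its adjacency matrix is in bank `1` (row by row). -/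
def OutputsGraph {m : ℕ} (s : State) (K : SimpleGraph (Fin m)) : Prop :=
  s.reg 1 = K.edgeSet.ncard ∧
    ∀ i j : Fin m, s.mem 1 (i.val * m + j.val) = if K.Adj i j then 1 else 0

end RandomAccess

/-! Work in `Hᶜ`, a line graph. An interval completion `K` of `H` leaves nonadjacent exactly those
pairs `u`, `v` of which one interval ends before the other begins, and these pairs are edges of
`Hᶜ`. So the task is to place as many edges of `Hᶜ` as possible in an interval order. Once the order
of the right endpoints is fixed (a key on the vertices), the best choice is to start `v` at the
least key of a vertex not `Hᶜ`-adjacent to `v`; this is `keyCompletion`.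

It remains to cut the orders down to polynomially many. If three edges of `G` all meet three further
edges, they share an endpoint `z`, and every edge meeting all three contains `z`. Hence in a line
graph the common neighbors of one side of a K₃,₃ form a clique (`commonNeighborsClique_lineGraph`).

Given `K`, let `a₁`, `a₂`, `a₃` be intervals that end early and `b`, `b'` intervals that begin late.
Consider `u` ending before `v` begins, with `u` not among the first three and `v` not among the last
two. Then `a₁`, `a₂`, `a₃` against `b`, `b'`, `v` is a K₃,₃ in `Hᶜ`, and both `u` and `v` lie in the
clique of common neighbors of `a₁`, `a₂`, `a₃`. Within this clique the order does not matter, so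
vertex numbers serve as keys. Thus the five vertices alone determine a key whose completion is
contained in `K` (`exists_keyCompletion_le`), and trying all `m ^ 5` tuples finds an optimum.

The search is written in a language whose only loops are countdowns from `m`. Termination and a
polynomial time bound then follow by induction on programs (`run_compile`), and correctness is
proved for the functional semantics `Code.sem`. -/

/-! ### Line graphs: common neighbors in a K₃,₃ -/

/-- If three distinct vertices are adjacent to three distinct vertices each, then the common
neighbors of the first three form a clique. -/
def CommonNeighborsClique {V : Type*} (L : SimpleGraph V) : Prop :=
  ∀ a₁ a₂ a₃ b₁ b₂ b₃ : V, a₁ ≠ a₂ → a₁ ≠ a₃ → a₂ ≠ a₃ → b₁ ≠ b₂ → b₁ ≠ b₃ → b₂ ≠ b₃ →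
    L.Adj a₁ b₁ → L.Adj a₁ b₂ → L.Adj a₁ b₃ → L.Adj a₂ b₁ → L.Adj a₂ b₂ → L.Adj a₂ b₃ →
    L.Adj a₃ b₁ → L.Adj a₃ b₂ → L.Adj a₃ b₃ →
    ∀ x y, L.Adj a₁ x → L.Adj a₂ x → L.Adj a₃ x → L.Adj a₁ y → L.Adj a₂ y → L.Adj a₃ y →
      x ≠ y → L.Adj x y

/-- Two edges share an endpoint. -/
def Meets {V : Type*} (e f : Sym2 V) : Prop := ∃ x, x ∈ e ∧ x ∈ f

theorem eq_of_meets_of_disjoint {V : Type*} {u v w x : V} {b : Sym2 V}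
    (huw : u ≠ w) (hux : u ≠ x) (hvw : v ≠ w) (hvx : v ≠ x)
    (h₁ : Meets s(u, v) b) (h₂ : Meets s(w, x) b) :
    b = s(u, w) ∨ b = s(u, x) ∨ b = s(v, w) ∨ b = s(v, x) := by
  induction b with | _ p q
  simp only [Meets, Sym2.mem_iff, Sym2.eq_iff] at *
  grind

/-- If `a₁` and `a₂` were disjoint, the edges meeting both would be the four edges of a 4-cycle. The
`bⱼ` would be three of them, forming a path on four vertices, and an edge meeting all three is the
middle edge of the path or one of `a₁`, `a₂`; so `a₃` could not exist. -/
theorem meets_of_meets_three {V : Type*} {a₁ a₂ a₃ b₁ b₂ b₃ : Sym2 V}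
    (la₁ : ¬ a₁.IsDiag) (la₂ : ¬ a₂.IsDiag) (la₃ : ¬ a₃.IsDiag)
    (h₁₃ : a₁ ≠ a₃) (h₂₃ : a₂ ≠ a₃) (k₁₂ : b₁ ≠ b₂) (k₁₃ : b₁ ≠ b₃) (k₂₃ : b₂ ≠ b₃)
    (n₃₁ : a₃ ≠ b₁) (n₃₂ : a₃ ≠ b₂) (n₃₃ : a₃ ≠ b₃)
    (m₁₁ : Meets a₁ b₁) (m₁₂ : Meets a₁ b₂) (m₁₃ : Meets a₁ b₃)
    (m₂₁ : Meets a₂ b₁) (m₂₂ : Meets a₂ b₂) (m₂₃ : Meets a₂ b₃)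
    (m₃₁ : Meets a₃ b₁) (m₃₂ : Meets a₃ b₂) (m₃₃ : Meets a₃ b₃) : Meets a₁ a₂ := by
  by_contra hm
  induction a₁ with | _ u v
  induction a₂ with | _ w x
  obtain ⟨huw, hux, hvw, hvx⟩ : u ≠ w ∧ u ≠ x ∧ v ≠ w ∧ v ≠ x := by
    refine ⟨fun h => hm ⟨u, ?_⟩, fun h => hm ⟨u, ?_⟩, fun h => hm ⟨v, ?_⟩, fun h => hm ⟨v, ?_⟩⟩ <;>
      simp [h]
  have key : ∀ {b}, Meets s(u, v) b → Meets s(w, x) b → _ :=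
    fun h h' => eq_of_meets_of_disjoint huw hux hvw hvx h h'
  induction a₃ with | _ p q
  rcases key m₁₁ m₂₁ with rfl | rfl | rfl | rfl <;> rcases key m₁₂ m₂₂ with rfl | rfl | rfl | rfl <;>
    first
    | exact absurd rfl k₁₂
    | (rcases key m₁₃ m₂₃ with rfl | rfl | rfl | rfl <;>
        first
        | exact absurd rfl k₁₃
        | exact absurd rfl k₂₃
        | (clear key m₁₁ m₁₂ m₁₃ m₂₁ m₂₂ m₂₃ k₁₂ k₁₃ k₂₃ hm
           simp only [Meets, Sym2.mem_iff, ne_eq, Sym2.eq_iff, Sym2.mk_isDiag_iff] at *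
           grind))

/-- Pairwise meeting edges form a star or a triangle. An edge meeting all three sides of a triangle
contains two of its corners, hence is a side; `b₁` therefore rules out the triangle. -/
theorem exists_common_vertex {V : Type*} {a₁ a₂ a₃ b₁ b₂ b₃ : Sym2 V}
    (la₁ : ¬ a₁.IsDiag) (la₂ : ¬ a₂.IsDiag) (la₃ : ¬ a₃.IsDiag)
    (lb₁ : ¬ b₁.IsDiag)
    (h₁₂ : a₁ ≠ a₂) (h₁₃ : a₁ ≠ a₃) (h₂₃ : a₂ ≠ a₃)
    (k₁₂ : b₁ ≠ b₂) (k₁₃ : b₁ ≠ b₃) (k₂₃ : b₂ ≠ b₃)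
    (n₁₁ : a₁ ≠ b₁) (n₁₂ : a₁ ≠ b₂) (n₁₃ : a₁ ≠ b₃)
    (n₂₁ : a₂ ≠ b₁) (n₂₂ : a₂ ≠ b₂) (n₂₃ : a₂ ≠ b₃)
    (n₃₁ : a₃ ≠ b₁) (n₃₂ : a₃ ≠ b₂) (n₃₃ : a₃ ≠ b₃)
    (m₁₁ : Meets a₁ b₁) (m₁₂ : Meets a₁ b₂) (m₁₃ : Meets a₁ b₃)
    (m₂₁ : Meets a₂ b₁) (m₂₂ : Meets a₂ b₂) (m₂₃ : Meets a₂ b₃)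
    (m₃₁ : Meets a₃ b₁) (m₃₂ : Meets a₃ b₂) (m₃₃ : Meets a₃ b₃) :
    ∃ x, x ∈ a₁ ∧ x ∈ a₂ ∧ x ∈ a₃ := by
  obtain ⟨x, x₁, x₂⟩ := meets_of_meets_three la₁ la₂ la₃ h₁₃ h₂₃ k₁₂ k₁₃ k₂₃ n₃₁ n₃₂ n₃₃
    m₁₁ m₁₂ m₁₃ m₂₁ m₂₂ m₂₃ m₃₁ m₃₂ m₃₃
  have q₁₃ := meets_of_meets_three la₁ la₃ la₂ h₁₂ h₂₃.symm k₁₂ k₁₃ k₂₃ n₂₁ n₂₂ n₂₃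
    m₁₁ m₁₂ m₁₃ m₃₁ m₃₂ m₃₃ m₂₁ m₂₂ m₂₃
  have q₂₃ := meets_of_meets_three la₂ la₃ la₁ h₁₂.symm h₁₃.symm k₁₂ k₁₃ k₂₃ n₁₁ n₁₂ n₁₃
    m₂₁ m₂₂ m₂₃ m₃₁ m₃₂ m₃₃ m₁₁ m₁₂ m₁₃
  obtain ⟨y, rfl⟩ := x₁
  obtain ⟨z, rfl⟩ := x₂
  refine ⟨x, by simp, by simp, ?_⟩
  by_contra hx
  clear m₁₂ m₁₃ m₂₂ m₂₃ m₃₂ m₃₃ k₁₂ k₁₃ k₂₃ n₁₂ n₁₃ n₂₂ n₂₃ n₃₂ n₃₃ h₁₃ h₂₃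
  induction a₃ with | _ p q
  induction b₁ with | _ r s
  simp only [Meets, Sym2.mem_iff, ne_eq, Sym2.eq_iff, Sym2.mk_isDiag_iff] at *
  grind

/-- Avoiding `x`, the edge `e` would have to contain the three distinct other endpoints. -/
theorem mem_of_meets {V : Type*} {a₁ a₂ a₃ e : Sym2 V} {x : V}
    (h₁₂ : a₁ ≠ a₂) (h₁₃ : a₁ ≠ a₃) (h₂₃ : a₂ ≠ a₃)
    (hx₁ : x ∈ a₁) (hx₂ : x ∈ a₂) (hx₃ : x ∈ a₃)
    (m₁ : Meets a₁ e) (m₂ : Meets a₂ e) (m₃ : Meets a₃ e) : x ∈ e := by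
  obtain ⟨y₁, rfl⟩ := hx₁
  obtain ⟨y₂, rfl⟩ := hx₂
  obtain ⟨y₃, rfl⟩ := hx₃
  induction e with | _ p q
  simp only [Meets, Sym2.mem_iff] at *
  have e₁₂ : y₁ ≠ y₂ := fun h => h₁₂ (by rw [h])
  have e₁₃ : y₁ ≠ y₃ := fun h => h₁₃ (by rw [h])
  have e₂₃ : y₂ ≠ y₃ := fun h => h₂₃ (by rw [h])
  grind

theorem commonNeighborsClique_lineGraph {V : Type*} (G : SimpleGraph V) :
    CommonNeighborsClique G.lineGraph := by
  have adj : ∀ e f : G.edgeSet, G.lineGraph.Adj e f ↔ e.1 ≠ f.1 ∧ Meets e.1 f.1 := by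
    intro e f
    simp only [SimpleGraph.lineGraph_adj_iff_exists, Meets, ne_eq, Subtype.ext_iff]
  have nd : ∀ e : G.edgeSet, ¬ e.1.IsDiag := fun e => G.not_isDiag_of_mem_edgeSet e.2
  have ne : ∀ e f : G.edgeSet, e ≠ f → e.1 ≠ f.1 := fun e f h h' => h (Subtype.ext h')
  intro a₁ a₂ a₃ b₁ b₂ b₃ h₁₂ h₁₃ h₂₃ k₁₂ k₁₃ k₂₃
  simp only [adj]
  intro j₁₁ j₁₂ j₁₃ j₂₁ j₂₂ j₂₃ j₃₁ j₃₂ j₃₃ x y x₁ x₂ x₃ y₁ y₂ y₃ hxy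
  obtain ⟨z, z₁, z₂, z₃⟩ := exists_common_vertex (nd a₁) (nd a₂) (nd a₃) (nd b₁)
    (ne _ _ h₁₂) (ne _ _ h₁₃) (ne _ _ h₂₃) (ne _ _ k₁₂) (ne _ _ k₁₃) (ne _ _ k₂₃)
    j₁₁.1 j₁₂.1 j₁₃.1 j₂₁.1 j₂₂.1 j₂₃.1 j₃₁.1 j₃₂.1 j₃₃.1
    j₁₁.2 j₁₂.2 j₁₃.2 j₂₁.2 j₂₂.2 j₂₃.2 j₃₁.2 j₃₂.2 j₃₃.2
  exact ⟨ne _ _ hxy, z,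
    mem_of_meets (ne _ _ h₁₂) (ne _ _ h₁₃) (ne _ _ h₂₃) z₁ z₂ z₃ x₁.2 x₂.2 x₃.2,
    mem_of_meets (ne _ _ h₁₂) (ne _ _ h₁₃) (ne _ _ h₂₃) z₁ z₂ z₃ y₁.2 y₂.2 y₃.2⟩

theorem CommonNeighborsClique.of_iso {V W : Type*} {L : SimpleGraph V} {L' : SimpleGraph W}
    (e : L ≃g L') (h : CommonNeighborsClique L') : CommonNeighborsClique L := by
  intro a₁ a₂ a₃ b₁ b₂ b₃ h₁₂ h₁₃ h₂₃ k₁₂ k₁₃ k₂₃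
  simp only [← e.map_adj_iff]
  intro j₁₁ j₁₂ j₁₃ j₂₁ j₂₂ j₂₃ j₃₁ j₃₂ j₃₃ x y x₁ x₂ x₃ y₁ y₂ y₃ hxy
  exact h _ _ _ _ _ _ (e.injective.ne h₁₂) (e.injective.ne h₁₃) (e.injective.ne h₂₃)
    (e.injective.ne k₁₂) (e.injective.ne k₁₃) (e.injective.ne k₂₃)
    j₁₁ j₁₂ j₁₃ j₂₁ j₂₂ j₂₃ j₃₁ j₃₂ j₃₃ _ _ x₁ x₂ x₃ y₁ y₂ y₃ (e.injective.ne hxy)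

theorem IsCoLineGraph.commonNeighborsClique_compl {V : Type*} {H : SimpleGraph V}
    (h : IsCoLineGraph H) : CommonNeighborsClique Hᶜ := by
  obtain ⟨n, G, ⟨e⟩⟩ := h
  refine CommonNeighborsClique.of_iso (L' := G.lineGraph) ⟨e.toEquiv, ?_⟩
    (commonNeighborsClique_lineGraph G)
  intro a b
  have h1 := e.map_adj_iff (v := a) (w := b)
  have h2 : e a ≠ e b ↔ a ≠ b := e.injective.ne_iff
  have h3 : G.lineGraph.Adj (e a) (e b) → e a ≠ e b := fun h => h.ne
  simp only [SimpleGraph.compl_adj] at *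
  change G.lineGraph.Adj (e a) (e b) ↔ _
  tauto

/-! ### The best completion for a given order of right endpoints -/

/-- The graph in which `u` and `v` are nonadjacent if all vertices whose key is at most that of `u`
are distinct from and `H`-nonadjacent to `v`, or the other way round. -/
def keyCompletion {V : Type*} (H : SimpleGraph V) (key : V → ℕ) : SimpleGraph V where
  Adj u v := u ≠ v ∧ (∃ w, key w ≤ key u ∧ ¬ Hᶜ.Adj w v) ∧ ∃ w, key w ≤ key v ∧ ¬ Hᶜ.Adj w u
  symm := ⟨fun _ _ h => ⟨h.1.symm, h.2.2, h.2.1⟩⟩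
  loopless := ⟨fun _ h => h.1 rfl⟩

/-- The interval of `v` runs from the least key of a vertex not `Hᶜ`-adjacent to `v` up to the key
of `v`. It is nonempty because `v` is not adjacent to itself. -/
theorem isIntervalCompletion_keyCompletion {V : Type*} (H : SimpleGraph V) (key : V → ℕ) :
    IsIntervalCompletion H (keyCompletion H key) := by
  classical
  have ex : ∀ v, ∃ k, ∃ w, key w = k ∧ ¬ Hᶜ.Adj w v := fun v => ⟨_, v, rfl, by simp⟩
  have le : ∀ u v, (∃ w, key w ≤ key u ∧ ¬ Hᶜ.Adj w v) ↔ Nat.find (ex v) ≤ key u := by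
    intro u v
    rw [Nat.find_le_iff]
    exact ⟨fun ⟨w, h, h'⟩ => ⟨_, h, w, rfl, h'⟩, fun ⟨_, h, w, e, h'⟩ => ⟨w, e ▸ h, h'⟩⟩
  refine ⟨fun u v h => ⟨h.ne, ⟨u, le_rfl, by simp [h]⟩, v, le_rfl, by simp [h.symm]⟩,
    fun v => (Nat.find (ex v) : ℕ), fun v => key v, fun v => ?_, fun u v => ?_⟩
  · exact Nat.cast_le.2 ((le v v).1 ⟨v, le_rfl, by simp⟩)
  · change u ≠ v ∧ _ ∧ _ ↔ _
    rw [le, le, Set.Icc_inter_Icc, Set.nonempty_Icc, sup_le_iff, le_inf_iff, le_inf_iff]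
    have hu := (le u u).1 ⟨u, le_rfl, by simp⟩
    have hv := (le v v).1 ⟨v, le_rfl, by simp⟩
    simp only [Nat.cast_le]
    tauto

/-! ### Keys determined by five vertices -/

open Classical in
/-- The key of `v` determined by the vertices `c₁`, `c₂`, `c₃`, `b`, `b'`. -/
noncomputable def tupleKey {m : ℕ} (H : SimpleGraph (Fin m)) (c₁ c₂ c₃ b b' v : Fin m) : ℕ :=
  if v = c₁ then 0
  else if v = c₂ then 1
  else if v = c₃ then 2
  -- The non-neighbors of `b`, then those of `b'`, come last, so that apart from the `cᵢ` every key
  -- up to `m + 4` belongs to a neighbor of `b`, and every key up to `m + 3` to a common neighbor of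
  -- `b` and `b'`.
  else if ¬ Hᶜ.Adj b v then m + 5
  else if ¬ Hᶜ.Adj b' v then m + 4
  -- Only injectivity and the range strictly between `2` and `m + 3` matter here.
  else if Hᶜ.Adj c₁ v ∧ Hᶜ.Adj c₂ v ∧ Hᶜ.Adj c₃ v then v + 3
  else m + 3

section Bounds

variable {m : ℕ} {H : SimpleGraph (Fin m)} {c₁ c₂ c₃ b b' w : Fin m}

theorem mem_of_tupleKey_le_zero (h : tupleKey H c₁ c₂ c₃ b b' w ≤ 0) : w = c₁ := by
  unfold tupleKey at h
  grind

theorem mem_of_tupleKey_le_one (h : tupleKey H c₁ c₂ c₃ b b' w ≤ 1) : w = c₁ ∨ w = c₂ := by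
  unfold tupleKey at h
  grind

theorem mem_of_tupleKey_le_two (h : tupleKey H c₁ c₂ c₃ b b' w ≤ 2) :
    w = c₁ ∨ w = c₂ ∨ w = c₃ := by
  unfold tupleKey at h
  grind

theorem mem_or_adj_of_tupleKey_lt (h : tupleKey H c₁ c₂ c₃ b b' w < m + 3) :
    (w = c₁ ∨ w = c₂ ∨ w = c₃) ∨ Hᶜ.Adj c₁ w ∧ Hᶜ.Adj c₂ w ∧ Hᶜ.Adj c₃ w ∧
      tupleKey H c₁ c₂ c₃ b b' w = w + 3 := by
  unfold tupleKey at h ⊢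
  grind

theorem mem_or_adj_of_tupleKey_le_three (h : tupleKey H c₁ c₂ c₃ b b' w ≤ m + 3) :
    (w = c₁ ∨ w = c₂ ∨ w = c₃) ∨ Hᶜ.Adj b w ∧ Hᶜ.Adj b' w := by
  unfold tupleKey at h
  grind

theorem mem_or_adj_of_tupleKey_le_four (h : tupleKey H c₁ c₂ c₃ b b' w ≤ m + 4) :
    (w = c₁ ∨ w = c₂ ∨ w = c₃) ∨ Hᶜ.Adj b w := by
  unfold tupleKey at h
  grind

theorem tupleKey_le_four (h : Hᶜ.Adj b w) : tupleKey H c₁ c₂ c₃ b b' w ≤ m + 4 := by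
  unfold tupleKey
  grind

theorem tupleKey_le_three (h : Hᶜ.Adj b w) (h' : Hᶜ.Adj b' w) :
    tupleKey H c₁ c₂ c₃ b b' w ≤ m + 3 := by
  unfold tupleKey
  grind

theorem tupleKey_eq (h : Hᶜ.Adj b w) (h' : Hᶜ.Adj b' w) (h₁ : Hᶜ.Adj c₁ w) (h₂ : Hᶜ.Adj c₂ w)
    (h₃ : Hᶜ.Adj c₃ w) : tupleKey H c₁ c₂ c₃ b b' w = w + 3 := by
  have := h₁.ne
  have := h₂.ne
  have := h₃.ne
  unfold tupleKey
  grind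

end Bounds

/-! ### Every completion contains one of the candidates -/

/-- The default `d` covers an empty range of choice, so that a tuple always exists, even if few
vertices qualify. -/
theorem exists_minimal {V : Type*} [Finite V] (p : V → Prop) (f : V → ℝ) (d : V) :
    ∃ a, (p a ∨ a = d ∧ ∀ v, ¬ p v) ∧ ∀ v, p v → f a ≤ f v := by
  by_cases h : ∃ v, p v
  · obtain ⟨a, ha, h'⟩ := Set.exists_min_image {v | p v} f (Set.toFinite _) h
    exact ⟨a, Or.inl ha, h'⟩
  · push Not at h
    exact ⟨d, Or.inr ⟨rfl, h⟩, fun v hv => absurd hv (h v)⟩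

/-- It suffices that pairs separated in `K` stay separated. Pairs involving one of the five chosen
vertices in its role are handled by the extreme keys, all others by the clique property. -/
theorem exists_keyCompletion_le {m : ℕ} (hm : 0 < m) {H K : SimpleGraph (Fin m)}
    (hH : CommonNeighborsClique Hᶜ) (hK : IsIntervalCompletion H K) :
    ∃ c₁ c₂ c₃ b b', keyCompletion H (tupleKey H c₁ c₂ c₃ b b') ≤ K := by
  obtain ⟨hHK, l, r, hlr, hadj⟩ := hK
  -- `a₁` ends first and `b` begins last. `a₂` and `a₃` are the next to end among the vertices that
  -- precede something other than `b`; this condition makes them precede `b'` as well. `b'` begins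
  -- last among the vertices other than `b` that lie after `a₁`.
  obtain ⟨a₁, ha₁, min₁⟩ := exists_minimal (fun _ => True) r ⟨0, hm⟩
  obtain ⟨b, hb, max₁⟩ := exists_minimal (fun _ => True) (fun v => -l v) ⟨0, hm⟩
  obtain ⟨a₂, ha₂, min₂⟩ :=
    exists_minimal (fun u => u ≠ a₁ ∧ ∃ v, v ≠ b ∧ r u < l v) r a₁
  obtain ⟨a₃, ha₃, min₃⟩ :=
    exists_minimal (fun u => u ≠ a₁ ∧ u ≠ a₂ ∧ ∃ v, v ≠ b ∧ r u < l v) r a₁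
  obtain ⟨b', hb', max₂⟩ :=
    exists_minimal (fun v => v ≠ b ∧ r a₁ < l v) (fun v => -l v) b
  replace min₁ : ∀ v, r a₁ ≤ r v := fun v => min₁ v trivial
  replace max₁ : ∀ v, l v ≤ l b := fun v => neg_le_neg_iff.1 (max₁ v trivial)
  replace max₂ : ∀ v, v ≠ b → r a₁ < l v → l v ≤ l b' :=
    fun v h h' => neg_le_neg_iff.1 (max₂ v ⟨h, h'⟩)
  refine ⟨a₁, a₂, a₃, b, b', ?_⟩
  have adj : ∀ {u v}, r u < l v → Hᶜ.Adj u v := by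
    intro u v h
    have hne : u ≠ v := by
      rintro rfl
      exact (hlr u).not_gt h
    refine (SimpleGraph.compl_adj _ _ _).2 ⟨hne, fun h' => ?_⟩
    obtain ⟨-, x, hx, hx'⟩ := (hadj u v).1 (hHK h')
    exact absurd (hx.2.trans_lt h) (not_lt.2 hx'.1)
  have main : ∀ u v, r u < l v → ¬ (keyCompletion H (tupleKey H a₁ a₂ a₃ b b')).Adj u v := by
    rintro u v huv ⟨hne, ⟨w, hw, hwv⟩, w', hw', hwu⟩
    have hab : r a₁ < l b := (min₁ u).trans_lt (huv.trans_le (max₁ v))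
    have hub : r u < l b := huv.trans_le (max₁ v)
    have hab' : r a₁ < l b' := by
      rcases hb' with h | h
      · exact h.2
      · rw [h.1]; exact hab
    have lt_b' : ∀ {c}, (∃ v, v ≠ b ∧ r c < l v) → r c < l b' := fun {c} ⟨x, hx, hcx⟩ =>
      hcx.trans_le (max₂ x hx ((min₁ c).trans_lt hcx))
    -- If nothing qualified, `a₂` is the default `a₁`, for which the inequality also holds.
    have h₂ : r a₂ < l b' := by
      rcases ha₂ with h | h
      · exact lt_b' h.2
      · rw [h.1]; exact hab'
    have h₃ : r a₃ < l b' := by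
      rcases ha₃ with h | h
      · exact lt_b' h.2.2
      · rw [h.1]; exact hab'
    by_cases hvb : v = b
    · subst hvb
      rcases mem_or_adj_of_tupleKey_le_four (hw.trans (tupleKey_le_four (adj hub).symm)) with
        (rfl | rfl | rfl) | h
      · exact hwv (adj hab)
      · exact hwv (adj (h₂.trans_le (max₁ b')))
      · exact hwv (adj (h₃.trans_le (max₁ b')))
      · exact hwv h.symm
    by_cases hvb' : v = b'
    · subst hvb'
      rcases mem_or_adj_of_tupleKey_le_three
        (hw.trans (tupleKey_le_three (adj hub).symm (adj huv).symm)) with (rfl | rfl | rfl) | h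
      · exact hwv (adj hab')
      · exact hwv (adj h₂)
      · exact hwv (adj h₃)
      · exact hwv h.2.symm
    -- From here on `v` is neither `b` nor `b'`, so `u` itself competes in the choice of `a₂` and
    -- `a₃`; this gives their minimality against `u` and later excludes the defaults.
    have hu : ∃ v, v ≠ b ∧ r u < l v := ⟨v, hvb, huv⟩
    have hub' := lt_b' hu
    have hbb' : b' ≠ b := by
      rcases hb' with h | h
      · exact h.1
      · exact absurd ⟨hvb, (min₁ u).trans_lt huv⟩ (h.2 v)
    have le₁ := min₁ u
    by_cases hu₁ : u = a₁
    · subst hu₁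
      have e : tupleKey H u a₂ a₃ b b' u = 0 := by simp [tupleKey]
      rw [mem_of_tupleKey_le_zero (hw.trans e.le)] at hwv
      exact hwv (adj huv)
    have le₂ := min₂ u ⟨hu₁, hu⟩
    by_cases hu₂ : u = a₂
    · subst hu₂
      have e : tupleKey H a₁ u a₃ b b' u = 1 := by simp [tupleKey, hu₁]
      rcases mem_of_tupleKey_le_one (hw.trans e.le) with rfl | rfl
      · exact hwv (adj (le₁.trans_lt huv))
      · exact hwv (adj huv)
    have le₃ := min₃ u ⟨hu₁, hu₂, hu⟩
    by_cases hu₃ : u = a₃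
    · subst hu₃
      have e : tupleKey H a₁ a₂ u b b' u = 2 := by simp [tupleKey, hu₁, hu₂]
      rcases mem_of_tupleKey_le_two (hw.trans e.le) with rfl | rfl | rfl
      · exact hwv (adj (le₁.trans_lt huv))
      · exact hwv (adj (le₂.trans_lt huv))
      · exact hwv (adj huv)
    have n₁₂ : a₁ ≠ a₂ := by
      rcases ha₂ with h | h
      · exact h.1.symm
      · exact absurd ⟨hu₁, hu⟩ (h.2 u)
    have n₃ : a₁ ≠ a₃ ∧ a₂ ≠ a₃ := by
      rcases ha₃ with h | h
      · exact ⟨h.1.symm, h.2.1.symm⟩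
      · exact absurd ⟨hu₁, hu₂, hu⟩ (h.2 u)
    have lt : ∀ {x}, r u < l x → Hᶜ.Adj a₁ x ∧ Hᶜ.Adj a₂ x ∧ Hᶜ.Adj a₃ x := fun h =>
      ⟨adj (le₁.trans_lt h), adj (le₂.trans_lt h), adj (le₃.trans_lt h)⟩
    obtain ⟨b₁, b₂, b₃⟩ := lt hub
    obtain ⟨d₁, d₂, d₃⟩ := lt hub'
    obtain ⟨v₁, v₂, v₃⟩ := lt huv
    -- The clique property with the sides exchanged: `u` and the `aᵢ` are common neighbors of `b`,
    -- `b'`, `v`, which makes `u` adjacent to each `aᵢ`.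
    have cliqueB := hH b b' v a₁ a₂ a₃ hbb'.symm (Ne.symm hvb) (Ne.symm hvb') n₁₂ n₃.1 n₃.2
      b₁.symm b₂.symm b₃.symm d₁.symm d₂.symm d₃.symm v₁.symm v₂.symm v₃.symm
    have adjU := fun {c} hcb hcb' hcv hcu =>
      cliqueB c u hcb hcb' hcv (adj hub).symm (adj hub').symm (adj huv).symm hcu
    have u₁ := adjU b₁.symm d₁.symm v₁.symm (Ne.symm hu₁)
    have u₂ := adjU b₂.symm d₂.symm v₂.symm (Ne.symm hu₂)
    have u₃ := adjU b₃.symm d₃.symm v₃.symm (Ne.symm hu₃)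
    have cliqueA := fun {x y} => hH a₁ a₂ a₃ b b' v n₁₂ n₃.1 n₃.2 hbb'.symm (Ne.symm hvb)
      (Ne.symm hvb') b₁ d₁ v₁ b₂ d₂ v₂ b₃ d₃ v₃ x y
    have ku : tupleKey H a₁ a₂ a₃ b b' u = u + 3 :=
      tupleKey_eq (adj hub).symm (adj hub').symm u₁ u₂ u₃
    have kv : tupleKey H a₁ a₂ a₃ b b' v = v + 3 :=
      tupleKey_eq (cliqueA b₁ b₂ b₃ v₁ v₂ v₃ (Ne.symm hvb))
        (cliqueA d₁ d₂ d₃ v₁ v₂ v₃ (Ne.symm hvb')) v₁ v₂ v₃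
    -- The keys may order `u` and `v` opposite to `K`. This is harmless: all vertices up to the
    -- smaller key are some `aᵢ` or lie in the clique, and differ from the vertex with the larger
    -- key.
    rcases lt_or_gt_of_ne hne with h | h
    · rcases mem_or_adj_of_tupleKey_lt (hw.trans_lt (by omega)) with (rfl | rfl | rfl) | hw₀
      · exact hwv v₁
      · exact hwv v₂
      · exact hwv v₃
      · refine hwv (cliqueA hw₀.1 hw₀.2.1 hw₀.2.2.1 v₁ v₂ v₃ ?_)
        rintro rfl
        omega
    · rcases mem_or_adj_of_tupleKey_lt (hw'.trans_lt (by omega)) with (rfl | rfl | rfl) | hw₀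
      · exact hwu u₁
      · exact hwu u₂
      · exact hwu u₃
      · refine hwu (cliqueA hw₀.1 hw₀.2.1 hw₀.2.2.1 u₁ u₂ u₃ ?_)
        rintro rfl
        omega
  intro u v h
  rw [hadj]
  refine ⟨h.ne, ?_⟩
  rw [Set.Icc_inter_Icc, Set.nonempty_Icc, sup_le_iff, le_inf_iff, le_inf_iff]
  exact ⟨⟨hlr u, not_lt.1 fun h' => main v u h' h.symm⟩, not_lt.1 fun h' => main u v h' h, hlr v⟩

/-! ### Programs with counting loops: semantics and running time -/

namespace RandomAccess

/-- Programs whose only loops run a counter `reg i` through `m - 1, …, 0`, where `m` is the value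
of register `0`. -/
inductive Code
  | skip
  | instr (c : Instr)
  | seq (p q : Code)
  | cond (i : ℕ) (p q : Code)
  | count (i : ℕ) (p : Code)

infixr:60 " ;; " => Code.seq

/-- Overwrite a register. -/
def State.set (s : State) (i x : ℕ) : State := { s with reg := Function.update s.reg i x }

namespace Code

/-- Register `2` is supposed to hold the constant `1`. -/
def compile : Code → Program
  | skip => .skip
  | instr c => .instr c
  | seq p q => .seq p.compile q.compile
  | cond i p q => .cond i p.compile q.compile
  -- The counter is decremented before the body, so the body sees `m - 1, …, 0` and the loop test
  -- sees one more than the next value.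
  | .count i p => .seq (.seq (.instr (.const i 0)) (.instr (.add i i 0)))
      (.loop i (.seq (.instr (.sub i i 2)) p.compile))

/-- Iterate `f`, with `reg i` running through `k - 1, …, 0`. -/
def countdown (f : State → State) (i : ℕ) : ℕ → State → State
  | 0, s => s
  | k + 1, s => countdown f i k (f (s.set i k))

/-- The final configuration. -/
def sem : Code → State → State
  | skip, s => s
  | instr c, s => c.apply s
  | seq p q, s => q.sem (p.sem s)
  | cond i p q, s => if s.reg i ≠ 0 then p.sem s else q.sem s
  | .count i p, s => countdown p.sem i (s.reg 0) (s.set i (s.reg 0))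

/-- Whether register `r` may be written. -/
def writesReg (r : ℕ) : Code → Bool
  | skip => false
  | instr (.const i _) => i == r
  | instr (.add i _ _) => i == r
  | instr (.sub i _ _) => i == r
  | instr (.load i _ _) => i == r
  | instr (.store _ _ _) => false
  | seq p q => p.writesReg r || q.writesReg r
  | cond _ p q => p.writesReg r || q.writesReg r
  | .count i p => i == r || p.writesReg r

/-- Whether memory bank `a` may be written. -/
def writesMem (a : ℕ) : Code → Bool
  | instr (.store a' _ _) => a' == a
  | seq p q => p.writesMem a || q.writesMem a
  | cond _ p q => p.writesMem a || q.writesMem a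
  | .count _ p => p.writesMem a
  | _ => false

/-- Loop bodies do not write the loop counter. -/
def WF : Code → Bool
  | seq p q => p.WF && q.WF
  | cond _ p q => p.WF && q.WF
  | .count i p => !p.writesReg i && p.WF
  | _ => true

/-- A bound on the number of steps, as a polynomial in the value of register `0`. -/
noncomputable def cost : Code → Polynomial ℕ
  | skip => 1
  | instr _ => 1
  | seq p q => p.cost + q.cost
  | cond _ p q => p.cost + q.cost + 1
  -- Two initializing instructions and the final test; each round adds a test and a decrement.
  | .count _ p => 3 + .X * (p.cost + 2)

theorem sem_countdown_induction {f : State → State} {i n : ℕ} (I : ℕ → State → Prop) {s : State}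
    (h₀ : I n s) (step : ∀ k s, k < n → I (k + 1) s → I k (f (s.set i k))) :
    I 0 (countdown f i n s) := by
  induction n generalizing s with
  | zero => exact h₀
  | succ n ih => exact ih (step n s n.lt_succ_self h₀) fun k s hk => step k s (hk.trans n.lt_succ_self)

/-- The invariant is indexed by the last counter value treated: typically `I k` says that all
vertices numbered at least `k` are done. -/
theorem sem_count_induction {i : ℕ} {p : Code} (I : ℕ → State → Prop) {s : State}
    (h₀ : I (s.reg 0) (s.set i (s.reg 0)))
    (step : ∀ k s', k < s.reg 0 → I (k + 1) s' → I k (p.sem (s'.set i k))) :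
    I 0 ((Code.count i p).sem s) :=
  sem_countdown_induction I h₀ step

theorem _root_.RandomAccess.State.set_reg_of_ne {s : State} {i j x : ℕ} (h : j ≠ i) : (s.set i x).reg j = s.reg j :=
  Function.update_of_ne h _ _

theorem _root_.RandomAccess.State.set_reg_self {s : State} {i x : ℕ} : (s.set i x).reg i = x :=
  Function.update_self _ _ _

/-- Frame rule: the hypothesis is a syntactic check, which evaluates by `rfl` or `decide` on
concrete programs. -/
theorem sem_reg {r : ℕ} {p : Code} (h : p.writesReg r = false) (s : State) :
    (p.sem s).reg r = s.reg r := by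
  induction p generalizing s with
  | skip => rfl
  | instr c =>
    cases c <;> simp only [writesReg, beq_eq_false_iff_ne] at h <;>
      first | rfl | exact Function.update_of_ne h.symm _ _
  | seq p q ihp ihq =>
    simp only [writesReg, Bool.or_eq_false_iff] at h
    simp only [sem, ihq h.2, ihp h.1]
  | cond i p q ihp ihq =>
    simp only [writesReg, Bool.or_eq_false_iff] at h
    simp only [sem]
    split_ifs
    · exact ihp h.1 s
    · exact ihq h.2 s
  | count i p ih =>
    simp only [writesReg, Bool.or_eq_false_iff, beq_eq_false_iff_ne] at h
    refine sem_count_induction (fun _ s' => s'.reg r = s.reg r) (State.set_reg_of_ne h.1.symm) ?_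
    intro k s' _ hs'
    rw [ih h.2, State.set_reg_of_ne h.1.symm, hs']

theorem sem_mem {a : ℕ} {p : Code} (h : p.writesMem a = false) (s : State) :
    (p.sem s).mem a = s.mem a := by
  induction p generalizing s with
  | skip => rfl
  | instr c =>
    cases c <;> first | rfl | skip
    simp only [writesMem, beq_eq_false_iff_ne] at h
    exact Function.update_of_ne h.symm _ _
  | seq p q ihp ihq =>
    simp only [writesMem, Bool.or_eq_false_iff] at h
    simp only [sem, ihq h.2, ihp h.1]
  | cond i p q ihp ihq =>
    simp only [writesMem, Bool.or_eq_false_iff] at h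
    simp only [sem]
    split_ifs
    · exact ihp h.1 s
    · exact ihq h.2 s
  | count i p ih =>
    simp only [writesMem] at h
    refine sem_count_induction (fun _ s' => s'.mem a = s.mem a) rfl ?_
    intro k s' _ hs'
    rw [ih h, ← hs']
    rfl

theorem run_loop {f : State → State} {i m T : ℕ} {q : Program}
    (hi₀ : i ≠ 0) (hi₂ : i ≠ 2) (hf : ∀ s r, r = 0 ∨ r = 2 ∨ r = i → (f s).reg r = s.reg r)
    (hq : ∀ s, s.reg 0 = m → s.reg 2 = 1 → ∃ t ≤ T, Run q s t (f s)) (k : ℕ) (s : State)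
    (h₀ : s.reg 0 = m) (h₂ : s.reg 2 = 1) (hk : s.reg i = k) :
    ∃ t ≤ k * (T + 2) + 1,
      Run (.loop i (.seq (.instr (.sub i i 2)) q)) s t (countdown f i k s) := by
  induction k generalizing s with
  | zero => exact ⟨1, by omega, .loop_done hk⟩
  | succ k ih =>
    have e : Instr.apply (.sub i i 2) s = s.set i k := by
      simp [Instr.apply, State.set, hk, h₂]
    have g₀ : (s.set i k).reg 0 = m := by rw [State.set_reg_of_ne hi₀.symm, h₀]
    have g₂ : (s.set i k).reg 2 = 1 := by rw [State.set_reg_of_ne hi₂.symm, h₂]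
    obtain ⟨t, ht, run⟩ := hq _ g₀ g₂
    obtain ⟨t', ht', run'⟩ := ih (f (s.set i k)) (by rw [hf _ 0 (by simp), g₀])
      (by rw [hf _ 2 (by simp), g₂]) (by rw [hf _ i (by simp)]; exact Function.update_self _ _ _)
    refine ⟨1 + t + t' + 1, by nlinarith, .loop_step (by omega) (.seq (.instr _ _) ?_) run'⟩
    rw [e]
    exact run

/-- No body changes its counter, the size in register `0` or the constant in register `2`, so each
loop makes exactly `reg 0` rounds, and the same bound holds for every round. -/
theorem run_compile {p : Code} (hp : p.WF = true) (h₀ : p.writesReg 0 = false)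
    (h₂ : p.writesReg 2 = false) {s : State} (hs : s.reg 2 = 1) :
    ∃ t ≤ p.cost.eval (s.reg 0), Run p.compile s t (p.sem s) := by
  induction p generalizing s with
  | skip => exact ⟨1, by simp [cost], .skip s⟩
  | instr c => exact ⟨1, by simp [cost], .instr c s⟩
  | seq p q ihp ihq =>
    simp only [writesReg, Bool.or_eq_false_iff] at h₀ h₂
    simp only [WF, Bool.and_eq_true] at hp
    obtain ⟨t, ht, run⟩ := ihp hp.1 h₀.1 h₂.1 hs
    obtain ⟨t', ht', run'⟩ := ihq hp.2 h₀.2 h₂.2 (s := p.sem s) (by rw [sem_reg h₂.1, hs])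
    rw [sem_reg h₀.1] at ht'
    exact ⟨t + t', by simpa [cost] using add_le_add ht ht', .seq run run'⟩
  | cond i p q ihp ihq =>
    simp only [writesReg, Bool.or_eq_false_iff] at h₀ h₂
    simp only [WF, Bool.and_eq_true] at hp
    simp only [cost, sem, Polynomial.eval_add, Polynomial.eval_one]
    split_ifs with hi
    · obtain ⟨t, ht, run⟩ := ihp hp.1 h₀.1 h₂.1 hs
      exact ⟨t + 1, by omega, .cond_true hi run⟩
    · obtain ⟨t, ht, run⟩ := ihq hp.2 h₀.2 h₂.2 hs
      exact ⟨t + 1, by omega, .cond_false (not_not.1 hi) run⟩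
  | count i p ih =>
    simp only [writesReg, Bool.or_eq_false_iff, beq_eq_false_iff_ne] at h₀ h₂
    simp only [WF, Bool.and_eq_true, Bool.not_eq_true'] at hp
    have g₀ : (s.set i (s.reg 0)).reg 0 = s.reg 0 := State.set_reg_of_ne h₀.1.symm
    obtain ⟨t, ht, run⟩ := run_loop (f := p.sem) (m := s.reg 0) h₀.1 h₂.1
      (by
        rintro s r (rfl | rfl | rfl)
        exacts [sem_reg h₀.2 s, sem_reg h₂.2 s, sem_reg hp.1 s])
      (fun s' h h' => by simpa only [h] using ih hp.2 h₀.2 h₂.2 (s := s') h')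
      (s.reg 0) (s.set i (s.reg 0)) g₀ (by rw [State.set_reg_of_ne h₂.1.symm, hs])
      (Function.update_self _ _ _)
    refine ⟨1 + 1 + t, ?_, .seq (.seq (.instr _ _) (.instr _ _)) ?_⟩
    · simp [cost]
      omega
    · have e : Instr.apply (.add i i 0) (Instr.apply (.const i 0) s) = s.set i (s.reg 0) := by
        simp [Instr.apply, State.set, h₀.1.symm]
      rw [e]
      exact run

end Code

end RandomAccess

/-! ### The search program -/

namespace RandomAccess

namespace Code

/-- `reg 4 := reg w * reg 0 + reg v` -/
def index (w v : ℕ) : Code :=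
  instr (.const 4 0) ;; count 3 (instr (.add 4 4 w)) ;; instr (.add 4 4 v)

/-- `reg 6` becomes nonzero iff `reg u ≠ reg v`. -/
def differ (u v : ℕ) : Code :=
  instr (.sub 6 u v) ;; instr (.sub 8 v u) ;; instr (.add 6 6 8)

/-- `reg 5` becomes nonzero iff the vertices `reg w` and `reg v` are equal or adjacent. -/
def meet (w v : ℕ) : Code :=
  index w v ;; instr (.load 5 0 4) ;; differ w v ;; cond 6 skip (instr (.const 5 1))

/-- `reg 7 := reg 0 + d` -/
def sizePlus (d : ℕ) : Code :=
  instr (.const 7 d) ;; instr (.add 7 7 0)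

/-- `reg 7` becomes the key of the vertex `reg 15` for the tuple in the registers `10, …, 14`. -/
def vertexKey : Code :=
  differ 15 10 ;; cond 6
    (differ 15 11 ;; cond 6
      (differ 15 12 ;; cond 6
        (meet 13 15 ;; cond 5 (sizePlus 5)
          (meet 14 15 ;; cond 5 (sizePlus 4)
            (meet 10 15 ;; cond 5 (sizePlus 3)
              (meet 11 15 ;; cond 5 (sizePlus 3)
                (meet 12 15 ;; cond 5 (sizePlus 3)
                  (instr (.const 7 3) ;; instr (.add 7 15 7)))))))
        (instr (.const 7 2)))
      (instr (.const 7 1)))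
    (instr (.const 7 0))

/-- Store the keys of all vertices in bank `2`. -/
def keys : Code := count 15 (vertexKey ;; instr (.store 2 15 7))

/-- `reg 7` becomes the minimum of itself and the keys of the neighbors of `reg 15`. -/
def vertexLow : Code :=
  count 16 (meet 16 15 ;; cond 5
    (instr (.load 8 2 16) ;; instr (.sub 9 7 8) ;; instr (.sub 7 7 9)) skip)

/-- Store the minimal key of a neighbor, or of the vertex itself, in bank `3`. -/
def lows : Code := count 15 (instr (.load 7 2 15) ;; vertexLow ;; instr (.store 3 15 7))

/-- `reg 9` becomes zero iff `reg u` and `reg v` are adjacent in the completion. -/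
def separate (u v : ℕ) : Code :=
  instr (.load 5 2 u) ;; instr (.load 7 3 v) ;; instr (.sub 9 7 5) ;;
  instr (.load 5 2 v) ;; instr (.load 7 3 u) ;; instr (.sub 7 7 5) ;; instr (.add 9 9 7) ;;
  differ u v ;; cond 6 skip (instr (.const 9 1))

/-- Count the edge `{reg 15, reg 16}` in `reg 17`, if it is one and `reg 15 < reg 16`. -/
def countEdge : Code :=
  instr (.sub 5 16 15) ;; cond 5
    (separate 15 16 ;; cond 9 skip (instr (.const 5 1) ;; instr (.add 17 17 5))) skip

/-- `reg 17` becomes the number of edges of the completion. -/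
def edgeCount : Code := instr (.const 17 0) ;; count 15 (count 16 countEdge)

/-- Write the entry of the adjacency matrix at `reg 15`, `reg 16` to bank `1`. -/
def writeEntry : Code :=
  separate 15 16 ;; cond 9 (instr (.const 5 0)) (instr (.const 5 1)) ;;
  index 15 16 ;; instr (.store 1 4 5)

/-- Write the adjacency matrix of the completion to bank `1`. -/
def writeMatrix : Code := count 15 (count 16 writeEntry)

/-- Compute the completion for the tuple in the registers `10, …, 14`, and replace the output by it
if that has fewer edges. -/
def tryTuple : Code :=
  keys ;; lows ;; edgeCount ;; instr (.sub 5 1 17) ;; cond 5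
    (instr (.const 1 0) ;; instr (.add 1 1 17) ;; writeMatrix) skip

/-- Set `reg 1` to the square of the number of vertices, then try all tuples. -/
def search : Code :=
  instr (.const 18 0) ;; index 0 18 ;; instr (.const 1 0) ;; instr (.add 1 1 4) ;;
  count 10 (count 11 (count 12 (count 13 (count 14 tryTuple))))

end Code

open Code

/-! ### Correctness: matrix indices and adjacency tests -/

theorem sem_index {w v : ℕ} (hw : w ≠ 4) (hw' : w ≠ 3) (hv : v ≠ 4) (hv' : v ≠ 3) (s : State) :
    ((index w v).sem s).reg 4 = s.reg w * s.reg 0 + s.reg v := by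
  have h := sem_count_induction (i := 3) (p := instr (.add 4 4 w))
    -- Multiplication by repeated addition: `k` summands are still missing.
    (fun k s' => s'.reg w = s.reg w ∧ s'.reg v = s.reg v ∧
      s'.reg 4 + s.reg w * k = s.reg w * s.reg 0) (s := (instr (.const 4 0)).sem s)
    (by simp [sem, Instr.apply, State.set, hw, hw', hv, hv'])
    (by
      rintro k s' - ⟨h₁, h₂, h₃⟩
      simp only [sem, Instr.apply, State.set]
      refine ⟨?_, ?_, ?_⟩
      · simpa [hw, hw'] using h₁
      · simpa [hv, hv'] using h₂
      · simp [hw', h₁]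
        rw [← h₃]
        ring)
  obtain ⟨h₁, h₂, h₃⟩ := h
  simp only [index, sem] at h₁ h₂ h₃ ⊢
  simp only [Instr.apply] at h₁ h₂ h₃ ⊢
  simp only [Function.update_self]
  rw [h₂]
  omega

theorem sem_differ {u v : ℕ} (hu : u ≠ 6) (hv : v ≠ 6) (s : State) :
    ((differ u v).sem s).reg 6 = 0 ↔ s.reg u = s.reg v := by
  simp [differ, sem, Instr.apply, hu, hv]
  omega

/-- `s` holds the input graph. -/
def Input {m : ℕ} (H : SimpleGraph (Fin m)) (s : State) : Prop :=
  s.reg 0 = m ∧ s.mem 0 = (inputGraph H).mem 0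

section

variable {m : ℕ} {H : SimpleGraph (Fin m)} {s : State}

theorem Input.sem (h : Input H s) {p : Code} (h₀ : p.writesReg 0 = false)
    (h₁ : p.writesMem 0 = false) : Input H (p.sem s) :=
  ⟨by rw [sem_reg h₀, h.1], by rw [sem_mem h₁, h.2]⟩

theorem Input.set (h : Input H s) {i x : ℕ} (hi : i ≠ 0) : Input H (s.set i x) :=
  ⟨by rw [State.set_reg_of_ne hi.symm, h.1], h.2⟩

theorem index_inj {i j i' j' : Fin m} :
    i.val * m + j.val = i'.val * m + j'.val ↔ i = i' ∧ j = j' := by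
  constructor
  · intro h
    have hj := congrArg (· % m) h
    simp [Nat.mul_add_mod_self_right, Nat.mod_eq_of_lt] at hj
    have hj' : j = j' := Fin.ext hj
    subst hj'
    have hi : i.val * m = i'.val * m := by omega
    exact ⟨Fin.ext (Nat.eq_of_mul_eq_mul_right j.pos hi), rfl⟩
  · rintro ⟨rfl, rfl⟩
    rfl

theorem inputGraph_mem (i j : Fin m) [Decidable (H.Adj i j)] :
    (inputGraph H).mem 0 (i.val * m + j.val) = if H.Adj i j then 1 else 0 := by
  have h : (∃ i' j' : Fin m, i.val * m + j.val = i'.val * m + j'.val ∧ H.Adj i' j') ↔ H.Adj i j := by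
    simp [index_inj]
  simp only [inputGraph, true_and, h]

theorem sem_meet {w v : ℕ} (hs : Input H s) (hw : w ∉ [3, 4, 5, 6, 8]) (hv : v ∉ [3, 4, 5, 6, 8])
    {x y : Fin m} (hx : s.reg w = x) (hy : s.reg v = y) :
    ((meet w v).sem s).reg 5 = 0 ↔ Hᶜ.Adj x y := by
  classical
  simp only [List.mem_cons, not_or] at hw hv
  have e₁ : (((index w v).sem s).mem 0 (((index w v).sem s).reg 4)) = if H.Adj x y then 1 else 0 := by
    rw [sem_mem rfl, sem_index hw.2.1 hw.1 hv.2.1 hv.1, hx, hy, hs.1, hs.2, inputGraph_mem]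
  have e₂ : ∀ {r}, r ≠ 4 → r ≠ 3 → ((index w v).sem s).reg r = s.reg r := by
    intro r h₄ h₃
    exact sem_reg (by simp [writesReg, index, h₄.symm, h₃.symm]) s
  have e₃ := sem_differ (u := w) (v := v) hw.2.2.2.1 hv.2.2.2.1
    ((instr (.load 5 0 4)).sem ((index w v).sem s))
  have e₄ : ((instr (.load 5 0 4)).sem ((index w v).sem s)).reg 5 = if H.Adj x y then 1 else 0 := by
    simp [sem, Instr.apply, e₁]
  have e₅ : ∀ {r}, r ≠ 5 → r ≠ 4 → r ≠ 3 →
      ((instr (.load 5 0 4)).sem ((index w v).sem s)).reg r = s.reg r := by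
    intro r h₅ h₄ h₃
    rw [← e₂ h₄ h₃]
    exact sem_reg (by simp [writesReg, h₅.symm]) _
  rw [e₅ hw.2.2.1 hw.2.1 hw.1, e₅ hv.2.2.1 hv.2.1 hv.1, hx, hy, Fin.val_inj] at e₃
  have e₆ : ((differ w v).sem ((instr (.load 5 0 4)).sem ((index w v).sem s))).reg 5 =
      if H.Adj x y then 1 else 0 := by
    rw [sem_reg rfl, e₄]
  change ((Code.cond 6 skip (instr (.const 5 1))).sem
    ((differ w v).sem ((instr (.load 5 0 4)).sem ((index w v).sem s)))).reg 5 = 0 ↔ _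
  rw [SimpleGraph.compl_adj]
  generalize (differ w v).sem ((instr (.load 5 0 4)).sem ((index w v).sem s)) = s' at *
  by_cases h : x = y
  · simp [sem, Instr.apply, e₃, h]
  · simp [sem, e₃, h, e₆]

end

end RandomAccess

/-! ### Correctness: keys, left endpoints and adjacency in the completion -/

namespace RandomAccess

open Code

/-- `s` holds the input graph and a tuple of vertices. -/
def Ready {m : ℕ} (H : SimpleGraph (Fin m)) (c₁ c₂ c₃ b b' : Fin m) (s : State) : Prop :=
  Input H s ∧ s.reg 10 = c₁ ∧ s.reg 11 = c₂ ∧ s.reg 12 = c₃ ∧ s.reg 13 = b ∧ s.reg 14 = b'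

/-- Matches one test of the program with one `if` of `tupleKey`. The condition corresponds to the
zero value of the register, hence to the second branch. -/
theorem sem_branch {p q r : Code} {i j x y : ℕ} {c : Prop} [Decidable c] {s : State}
    (h : (p.sem s).reg i = 0 ↔ c) (h₁ : c → (r.sem (p.sem s)).reg j = x)
    (h₂ : ¬ c → (q.sem (p.sem s)).reg j = y) :
    ((p ;; .cond i q r).sem s).reg j = if c then x else y := by
  change (if (p.sem s).reg i ≠ 0 then _ else _ : State).reg j = _
  by_cases hc : c
  · rw [if_neg (not_not.2 (h.2 hc)), if_pos hc, h₁ hc]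
  · rw [if_pos (mt h.1 hc), if_neg hc, h₂ hc]

section

variable {m : ℕ} {H : SimpleGraph (Fin m)} {c₁ c₂ c₃ b b' : Fin m} {s : State}

theorem Ready.sem (h : Ready H c₁ c₂ c₃ b b' s) {p : Code}
    (h₀ : ∀ r ∈ [0, 10, 11, 12, 13, 14], p.writesReg r = false) (h₁ : p.writesMem 0 = false) :
    Ready H c₁ c₂ c₃ b b' (p.sem s) := by
  obtain ⟨hs, g₁, g₂, g₃, g₄, g₅⟩ := h
  refine ⟨hs.sem (h₀ 0 (by simp)) h₁, ?_, ?_, ?_, ?_, ?_⟩ <;> rw [sem_reg (h₀ _ (by simp))] <;>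
    assumption

theorem Ready.set (h : Ready H c₁ c₂ c₃ b b' s) {i x : ℕ} (hi : i ∉ [0, 10, 11, 12, 13, 14]) :
    Ready H c₁ c₂ c₃ b b' (s.set i x) := by
  obtain ⟨hs, g₁, g₂, g₃, g₄, g₅⟩ := h
  simp only [List.mem_cons, not_or] at hi
  refine ⟨hs.set hi.1, ?_, ?_, ?_, ?_, ?_⟩ <;> rw [State.set_reg_of_ne (by omega)] <;> assumption

theorem sem_sizePlus (hs : Input H s) (d : ℕ) : ((sizePlus d).sem s).reg 7 = m + d := by
  simp [sizePlus, Code.sem, Instr.apply, hs.1, add_comm]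

theorem sem_vertexKey (hs : Ready H c₁ c₂ c₃ b b' s) {v : Fin m} (hv : s.reg 15 = v) :
    (vertexKey.sem s).reg 7 = tupleKey H c₁ c₂ c₃ b b' v := by
  classical
  have eq : ∀ {s' : State} {r} {x : Fin m}, r ≠ 6 → s'.reg 15 = v → s'.reg r = x →
      (((differ 15 r).sem s').reg 6 = 0 ↔ v = x) := by
    intro s' r x hr h₁ h₂
    rw [sem_differ (by decide) hr, h₁, h₂, Fin.val_inj]
  have dR : ∀ {s' : State} {r}, Ready H c₁ c₂ c₃ b b' s' → s'.reg 15 = v →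
      Ready H c₁ c₂ c₃ b b' ((differ 15 r).sem s') ∧ ((differ 15 r).sem s').reg 15 = v :=
    fun h h' => ⟨h.sem (by simp [differ, writesReg]) rfl, by rw [sem_reg (by simp [differ, writesReg]), h']⟩
  have mR : ∀ {s' : State} {r}, Ready H c₁ c₂ c₃ b b' s' → s'.reg 15 = v →
      Ready H c₁ c₂ c₃ b b' ((meet r 15).sem s') ∧ ((meet r 15).sem s').reg 15 = v :=
    fun h h' => ⟨h.sem (by simp [meet, index, differ, writesReg]) rfl,
      by rw [sem_reg (by simp [meet, index, differ, writesReg]), h']⟩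
  unfold vertexKey tupleKey
  refine sem_branch (eq (by decide) hv hs.2.1) (fun _ => rfl) fun _ => ?_
  obtain ⟨hs, hv⟩ := dR hs hv
  refine sem_branch (eq (by decide) hv hs.2.2.1) (fun _ => rfl) fun _ => ?_
  obtain ⟨hs, hv⟩ := dR hs hv
  refine sem_branch (eq (by decide) hv hs.2.2.2.1) (fun _ => rfl) fun _ => ?_
  obtain ⟨hs, hv⟩ := dR hs hv
  rw [ite_not]
  refine sem_branch (sem_meet hs.1 (by decide) (by decide) hs.2.2.2.2.1 hv) (fun _ => ?_) fun _ =>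
    sem_sizePlus (mR hs hv).1.1 5
  obtain ⟨hs, hv⟩ := mR hs hv
  rw [ite_not]
  refine sem_branch (sem_meet hs.1 (by decide) (by decide) hs.2.2.2.2.2 hv) (fun _ => ?_) fun _ =>
    sem_sizePlus (mR hs hv).1.1 4
  obtain ⟨hs, hv⟩ := mR hs hv
  rw [ite_and]
  refine sem_branch (sem_meet hs.1 (by decide) (by decide) hs.2.1 hv) (fun _ => ?_) fun _ =>
    sem_sizePlus (mR hs hv).1.1 3
  obtain ⟨hs, hv⟩ := mR hs hv
  rw [ite_and]
  refine sem_branch (sem_meet hs.1 (by decide) (by decide) hs.2.2.1 hv) (fun _ => ?_) fun _ =>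
    sem_sizePlus (mR hs hv).1.1 3
  obtain ⟨hs, hv⟩ := mR hs hv
  refine sem_branch (sem_meet hs.1 (by decide) (by decide) hs.2.2.2.1 hv) (fun _ => ?_) fun _ =>
    sem_sizePlus (mR hs hv).1.1 3
  obtain ⟨hs, hv⟩ := mR (r := 12) hs hv
  simp [Code.sem, Instr.apply, hv]

theorem sem_keys (hs : Ready H c₁ c₂ c₃ b b' s) (v : Fin m) :
    (keys.sem s).mem 2 v = tupleKey H c₁ c₂ c₃ b b' v := by
  have h := sem_count_induction (i := 15) (p := vertexKey ;; instr (.store 2 15 7))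
    (fun k s' => Ready H c₁ c₂ c₃ b b' s' ∧
      ∀ v : Fin m, k ≤ v → s'.mem 2 v = tupleKey H c₁ c₂ c₃ b b' v) (s := s)
    ⟨hs.set (by decide), fun v hv => by rw [hs.1.1] at hv; omega⟩ ?_
  · exact h.2 v (Nat.zero_le _)
  · rintro k s' hk ⟨hs', ih⟩
    rw [hs.1.1] at hk
    have hR : Ready H c₁ c₂ c₃ b b' (s'.set 15 k) := hs'.set (by decide)
    have h15 : (s'.set 15 k).reg 15 = (⟨k, hk⟩ : Fin m) := State.set_reg_self
    refine ⟨hR.sem (by decide) (by decide), fun v hv => ?_⟩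
    have e : ((vertexKey ;; instr (.store 2 15 7)).sem (s'.set 15 k)).mem 2 =
        Function.update (s'.mem 2) k (tupleKey H c₁ c₂ c₃ b b' ⟨k, hk⟩) := by
      change Function.update (vertexKey.sem (s'.set 15 k)).mem 2 (Function.update
        ((vertexKey.sem (s'.set 15 k)).mem 2) ((vertexKey.sem (s'.set 15 k)).reg 15)
        ((vertexKey.sem (s'.set 15 k)).reg 7)) 2 = _
      rw [Function.update_self, sem_vertexKey hR h15, sem_reg rfl, sem_mem rfl, h15]
      rfl
    rw [e]
    rcases eq_or_lt_of_le hv with h | h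
    · subst h
      exact Function.update_self _ _ _
    · rw [Function.update_of_ne h.ne', ih v h]

/-- `s` holds the input graph and a key for each vertex. -/
def HasKeys (H : SimpleGraph (Fin m)) (key : Fin m → ℕ) (s : State) : Prop :=
  Input H s ∧ ∀ v : Fin m, s.mem 2 v = key v

variable {key : Fin m → ℕ}

theorem HasKeys.sem (h : HasKeys H key s) {p : Code} (h₀ : p.writesReg 0 = false)
    (h₁ : p.writesMem 0 = false) (h₂ : p.writesMem 2 = false) : HasKeys H key (p.sem s) :=
  ⟨h.1.sem h₀ h₁, fun v => by rw [sem_mem h₂, h.2]⟩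

theorem HasKeys.set (h : HasKeys H key s) {i x : ℕ} (hi : i ≠ 0) : HasKeys H key (s.set i x) :=
  ⟨h.1.set hi, h.2⟩

/-- The minimum is described by its strict lower bounds, which turn each update into one more
conjunct. -/
theorem sem_vertexLow (hs : HasKeys H key s) {v : Fin m} (hv : s.reg 15 = v) (x : ℕ) :
    x < (vertexLow.sem s).reg 7 ↔ x < s.reg 7 ∧ ∀ w, ¬ Hᶜ.Adj w v → x < key w := by
  have h := sem_count_induction (i := 16) (p := meet 16 15 ;; .cond 5
      (instr (.load 8 2 16) ;; instr (.sub 9 7 8) ;; instr (.sub 7 7 9)) skip)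
    (fun k s' => HasKeys H key s' ∧ s'.reg 15 = v ∧
      (x < s'.reg 7 ↔ x < s.reg 7 ∧ ∀ w : Fin m, k ≤ w → ¬ Hᶜ.Adj w v → x < key w)) (s := s)
    ⟨hs.set (by decide), hv, ?_⟩ ?_
  · have h' := h.2.2
    simp only [Nat.zero_le, true_imp_iff] at h'
    exact h'
  · rw [State.set_reg_of_ne (by decide), hs.1.1]
    have : ∀ w : Fin m, ¬ m ≤ w := fun w => by omega
    simp [this]
  · rintro k s' hk ⟨hs', hv', ih⟩
    rw [hs.1.1] at hk
    have hR : HasKeys H key (s'.set 16 k) := hs'.set (by decide)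
    have h16 : (s'.set 16 k).reg 16 = (⟨k, hk⟩ : Fin m) := State.set_reg_self
    have h15 : (s'.set 16 k).reg 15 = v := by rw [State.set_reg_of_ne (by decide), hv']
    have h7 : (s'.set 16 k).reg 7 = s'.reg 7 := State.set_reg_of_ne (by decide)
    refine ⟨hR.sem (by decide) (by decide) (by decide), by rw [sem_reg (by decide), h15], ?_⟩
    have hm := sem_meet hR.1 (by decide) (by decide) h16 h15
    have hR' := hR.sem (p := meet 16 15) rfl rfl rfl
    have g7 : ((meet 16 15).sem (s'.set 16 k)).reg 7 = s'.reg 7 := by rw [sem_reg rfl, h7]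
    have g16 : ((meet 16 15).sem (s'.set 16 k)).reg 16 = (⟨k, hk⟩ : Fin m) := by
      rw [sem_reg rfl, h16]
    rw [Code.sem]
    generalize (meet 16 15).sem (s'.set 16 k) = t at *
    have split : (∀ w : Fin m, k ≤ w → ¬ Hᶜ.Adj w v → x < key w) ↔
        (¬ Hᶜ.Adj ⟨k, hk⟩ v → x < key ⟨k, hk⟩) ∧
          ∀ w : Fin m, k + 1 ≤ w → ¬ Hᶜ.Adj w v → x < key w := by
      constructor
      · exact fun h => ⟨h ⟨k, hk⟩ le_rfl, fun w hw => h w (by omega)⟩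
      · rintro ⟨h₁, h₂⟩ w hw
        rcases eq_or_lt_of_le hw with h | h
        · have : w = ⟨k, hk⟩ := Fin.ext h.symm
          subst this
          exact h₁
        · exact h₂ w h
    rw [split]
    by_cases hadj : Hᶜ.Adj ⟨k, hk⟩ v
    · simp only [Code.sem, hm.2 hadj, ne_eq, not_true_eq_false, if_false, g7, ih, hadj,
        false_imp_iff, true_and]
    · have e := hR'.2 ⟨k, hk⟩
      rw [← g16] at e
      -- With truncated subtraction, `a - (a - b) = min a b`.
      have e7 : ((instr (.load 8 2 16) ;; instr (.sub 9 7 8) ;; instr (.sub 7 7 9)).sem t).reg 7 =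
          min (s'.reg 7) (key ⟨k, hk⟩) := by
        simp [Code.sem, Instr.apply, g7, e]
        omega
      have hne : t.reg 5 ≠ 0 := mt hm.1 hadj
      rw [Code.sem, if_pos hne, e7, lt_min_iff, ih]
      simp only [hadj, not_false_eq_true, true_imp_iff]
      tauto

/-- `s` holds the input graph, the keys, and the left endpoints of the intervals. -/
def HasLows (H : SimpleGraph (Fin m)) (key : Fin m → ℕ) (s : State) : Prop :=
  HasKeys H key s ∧ ∀ (v : Fin m) (x : ℕ), s.mem 3 v ≤ x ↔ ∃ w, key w ≤ x ∧ ¬ Hᶜ.Adj w v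

theorem HasLows.sem (h : HasLows H key s) {p : Code} (h₀ : p.writesReg 0 = false)
    (h₁ : p.writesMem 0 = false) (h₂ : p.writesMem 2 = false) (h₃ : p.writesMem 3 = false) :
    HasLows H key (p.sem s) :=
  ⟨h.1.sem h₀ h₁ h₂, fun v => by rw [sem_mem h₃]; exact h.2 v⟩

theorem HasLows.set (h : HasLows H key s) {i x : ℕ} (hi : i ≠ 0) : HasLows H key (s.set i x) :=
  ⟨h.1.set hi, h.2⟩

theorem sem_lows (hs : HasKeys H key s) : HasLows H key (lows.sem s) := by
  refine ⟨hs.sem rfl rfl rfl, ?_⟩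
  have h := sem_count_induction (i := 15)
    (p := instr (.load 7 2 15) ;; vertexLow ;; instr (.store 3 15 7))
    (fun k s' => HasKeys H key s' ∧ ∀ v : Fin m, k ≤ v → ∀ x,
      (s'.mem 3 v ≤ x ↔ ∃ w, key w ≤ x ∧ ¬ Hᶜ.Adj w v)) (s := s)
    ⟨hs.set (by decide), fun v hv => by rw [hs.1.1] at hv; omega⟩ ?_
  · exact fun v => h.2 v (Nat.zero_le _)
  · rintro k s' hk ⟨hs', ih⟩
    rw [hs.1.1] at hk
    have hR : HasKeys H key (s'.set 15 k) := hs'.set (by decide)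
    have h15 : (s'.set 15 k).reg 15 = (⟨k, hk⟩ : Fin m) := State.set_reg_self
    refine ⟨hR.sem (by decide) (by decide) (by decide), fun v hv x => ?_⟩
    have hR' := hR.sem (p := instr (.load 7 2 15)) rfl rfl rfl
    have g15 : ((instr (.load 7 2 15)).sem (s'.set 15 k)).reg 15 = (⟨k, hk⟩ : Fin m) := by
      rw [sem_reg rfl, h15]
    have g7 : ((instr (.load 7 2 15)).sem (s'.set 15 k)).reg 7 = key ⟨k, hk⟩ := by
      have := hR.2 ⟨k, hk⟩
      simpa [Code.sem, Instr.apply, h15] using this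
    have low := sem_vertexLow hR' g15
    rw [g7] at low
    have e : ((instr (.load 7 2 15) ;; vertexLow ;; instr (.store 3 15 7)).sem (s'.set 15 k)).mem 3 =
        Function.update (s'.mem 3) k
          ((vertexLow.sem ((instr (.load 7 2 15)).sem (s'.set 15 k))).reg 7) := by
      rw [Code.sem, Code.sem]
      generalize ht : (instr (.load 7 2 15)).sem (s'.set 15 k) = t at *
      change Function.update (vertexLow.sem t).mem 3 (Function.update
        ((vertexLow.sem t).mem 3) ((vertexLow.sem t).reg 15) _) 3 = _
      rw [Function.update_self, sem_reg rfl, sem_mem rfl, g15, ← ht]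
      rfl
    rw [e]
    rcases eq_or_lt_of_le hv with h | h
    · have : v = ⟨k, hk⟩ := Fin.ext h.symm
      subst this
      rw [Function.update_self, ← not_lt, low]
      constructor
      · intro h
        -- The initial value, the key of the vertex itself, adds no new bound, since the vertex is
        -- not adjacent to itself.
        by_contra! h'
        exact h ⟨by_contra fun h'' => absurd (h' _ (not_lt.1 h'')) (by simp),
          fun w hw => by_contra fun h'' => hw (h' w (not_lt.1 h''))⟩
      · rintro ⟨w, hw, hw'⟩ ⟨-, h⟩
        exact absurd (h w hw') (not_lt.2 hw)
    · rw [Function.update_of_ne h.ne', ih v h]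

/-- A sum of truncated differences vanishes iff both do, that is, iff each left endpoint is at most
the other right endpoint. Equal vertices are overridden with `1`, to exclude loops. -/
theorem sem_separate (hs : HasLows H key s) {u v : ℕ} (hu : u ∉ [5, 6, 7, 8, 9])
    (hv : v ∉ [5, 6, 7, 8, 9]) {x y : Fin m} (hx : s.reg u = x) (hy : s.reg v = y) :
    ((separate u v).sem s).reg 9 = 0 ↔ (keyCompletion H key).Adj x y := by
  simp only [List.mem_cons, not_or] at hu hv
  obtain ⟨hu₅, hu₆, hu₇, hu₈, hu₉, -⟩ := hu
  obtain ⟨hv₅, hv₆, hv₇, hv₈, hv₉, -⟩ := hv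
  have e : ∃ t : State, (separate u v).sem s =
      (differ u v ;; .cond 6 skip (instr (.const 9 1))).sem t ∧ t.reg u = x ∧ t.reg v = y ∧
      t.reg 9 = (s.mem 3 y - s.mem 2 x) + (s.mem 3 x - s.mem 2 y) := by
    refine ⟨_, rfl, ?_, ?_, ?_⟩ <;> simp [Instr.apply, Code.sem, *]
  obtain ⟨t, e, tx, ty, t₉⟩ := e
  rw [hs.1.2, hs.1.2] at t₉
  have h₁ := hs.2 y (key x)
  have h₂ := hs.2 x (key y)
  have d := sem_differ hu₆ hv₆ t
  rw [tx, ty, Fin.val_inj] at d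
  have d₉ : ((differ u v).sem t).reg 9 = t.reg 9 := sem_reg rfl t
  rw [e]
  change (if _ then _ else _ : State).reg 9 = 0 ↔
    x ≠ y ∧ (∃ w, key w ≤ key x ∧ ¬ Hᶜ.Adj w y) ∧ ∃ w, key w ≤ key y ∧ ¬ Hᶜ.Adj w x
  rw [← h₁, ← h₂]
  by_cases hxy : x = y
  · rw [if_neg (not_not.2 (d.2 hxy))]
    simp [Code.sem, Instr.apply, hxy]
  · rw [if_pos (mt d.1 hxy)]
    simp only [Code.sem, d₉, t₉, ne_eq, hxy, not_false_eq_true, true_and, Nat.add_eq_zero_iff,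
      tsub_eq_zero_iff_le]

end

end RandomAccess

/-! ### Correctness: edge count and output matrix -/

open Finset in
theorem SimpleGraph.ncard_edgeSet_eq_card_lt {V : Type*} [Fintype V] [LinearOrder V]
    (K : SimpleGraph V) [DecidableRel K.Adj] :
    K.edgeSet.ncard = #{p : V × V | p.1 < p.2 ∧ K.Adj p.1 p.2} := by
  rw [← Set.ncard_coe_finset]
  symm
  refine Set.ncard_congr (fun p _ => s(p.1, p.2)) ?_ ?_ ?_
  · rintro ⟨u, v⟩ h
    simpa using (by simpa using h : u < v ∧ K.Adj u v).2
  · rintro ⟨u, v⟩ ⟨u', v'⟩ h h' e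
    simp only [coe_filter, mem_univ, true_and, Set.mem_ofPred_eq] at h h'
    rcases Sym2.eq_iff.1 e with ⟨rfl, rfl⟩ | ⟨rfl, rfl⟩
    · rfl
    · exact absurd h.1 h'.1.asymm
  · intro e he
    induction e with | _ u v
    have huv : K.Adj u v := he
    rcases lt_or_gt_of_ne huv.ne with h | h
    · exact ⟨(u, v), by simp [h, huv], rfl⟩
    · exact ⟨(v, u), by simp [h, huv.symm], Sym2.eq_swap⟩

namespace RandomAccess

open Code

section

variable {m : ℕ} {H : SimpleGraph (Fin m)} {key : Fin m → ℕ} {s : State}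

open Classical in
theorem sem_countEdge (hs : HasLows H key s) {x y : Fin m} (hx : s.reg 15 = x)
    (hy : s.reg 16 = y) :
    (countEdge.sem s).reg 17 =
      s.reg 17 + if x < y ∧ (keyCompletion H key).Adj x y then 1 else 0 := by
  have hs' := hs.sem (p := instr (.sub 5 16 15)) rfl rfl rfl rfl
  have hx' : ((instr (.sub 5 16 15)).sem s).reg 15 = x := by rw [sem_reg rfl, hx]
  have hy' : ((instr (.sub 5 16 15)).sem s).reg 16 = y := by rw [sem_reg rfl, hy]
  have h₁₇ : ((instr (.sub 5 16 15)).sem s).reg 17 = s.reg 17 := sem_reg rfl _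
  have h₅ : ((instr (.sub 5 16 15)).sem s).reg 5 = y - x := by simp [Code.sem, Instr.apply, hx, hy]
  rw [countEdge, Code.sem]
  generalize (instr (.sub 5 16 15)).sem s = t at *
  by_cases hlt : x < y
  · rw [Code.sem, if_pos (by omega)]
    have hsep := sem_separate hs' (by decide) (by decide) hx' hy'
    have h₁₇' : ((separate 15 16).sem t).reg 17 = s.reg 17 := by rw [sem_reg rfl, h₁₇]
    rw [Code.sem]
    generalize (separate 15 16).sem t = t' at *
    by_cases hK : (keyCompletion H key).Adj x y
    · rw [Code.sem, if_neg (not_not.2 (hsep.2 hK))]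
      simp [Code.sem, Instr.apply, h₁₇', hlt, hK]
    · rw [Code.sem, if_pos (mt hsep.1 hK)]
      simp [Code.sem, h₁₇', hK]
  · rw [Code.sem, if_neg (by omega)]
    simp [Code.sem, h₁₇, hlt]

/-- Two nested loops over all pairs of vertices. -/
theorem sem_count_count_induction {i j : ℕ} {p : Code} (hi : i ≠ 0) (hj : j ≠ 0) (hij : i ≠ j)
    (hp : p.writesReg 0 = false) (hpi : p.writesReg i = false) (I : Set (Fin m × Fin m) → State → Prop)
    (hset : ∀ S s r x, r = i ∨ r = j → I S s → I S (s.set r x))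
    (h₀ : s.reg 0 = m) (hI : I ∅ s)
    (step : ∀ (x y : Fin m) (S : Set (Fin m × Fin m)) (s : State), (x, y) ∉ S → s.reg i = x →
      s.reg j = y → I S s → I (insert (x, y) S) (p.sem s)) :
    I Set.univ ((count i (count j p)).sem s) := by
  have main := sem_count_induction (i := i) (p := count j p)
    (fun k s' => s'.reg 0 = m ∧ I {q | k ≤ q.1.val} s') (s := s)
    ⟨by rw [State.set_reg_of_ne hi.symm, h₀], hset _ _ _ _ (.inl rfl) ?_⟩ ?_
  · simpa using main.2
  · convert hI
    ext q
    simp [h₀]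
  · rintro k s' hk ⟨hs', ih⟩
    rw [h₀] at hk
    have h₀' : (s'.set i k).reg 0 = m := by rw [State.set_reg_of_ne hi.symm, hs']
    have inner := sem_count_induction (i := j) (p := p)
      (fun l s'' => s''.reg 0 = m ∧ s''.reg i = k ∧
        -- The pairs treated so far: all complete rows above `k`, and the columns from `l` on in row
        -- `k`.
        I {q | k + 1 ≤ q.1.val ∨ q.1.val = k ∧ l ≤ q.2.val} s'') (s := s'.set i k)
      ⟨by rw [State.set_reg_of_ne hj.symm, h₀'], by rw [State.set_reg_of_ne hij, State.set_reg_self],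
        hset _ _ _ _ (.inr rfl) (hset _ _ _ _ (.inl rfl) ?_)⟩ ?_
    · refine ⟨inner.1, ?_⟩
      convert inner.2.2 using 1
      ext q
      simp
      omega
    · convert ih using 1
      ext q
      simp [h₀']
    · rintro l s'' hl ⟨g₀, g₁, ih'⟩
      rw [h₀'] at hl
      refine ⟨by rw [sem_reg hp, State.set_reg_of_ne hj.symm, g₀],
        by rw [sem_reg hpi, State.set_reg_of_ne hij, g₁], ?_⟩
      convert step ⟨k, hk⟩ ⟨l, hl⟩ _ (s''.set j l) ?_ (by rw [State.set_reg_of_ne hij, g₁])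
        State.set_reg_self (hset _ _ _ _ (.inr rfl) ih') using 1
      · ext ⟨a, b⟩
        simp [Fin.ext_iff]
        omega
      · simp

theorem sem_edgeCount (hs : HasLows H key s) :
    (edgeCount.sem s).reg 17 = (keyCompletion H key).edgeSet.ncard := by
  classical
  rw [SimpleGraph.ncard_edgeSet_eq_card_lt]
  have h := sem_count_count_induction (i := 15) (j := 16) (p := countEdge) (by decide) (by decide)
    (by decide) rfl rfl
    (fun S s' => HasLows H key s' ∧ s'.reg 17 = Finset.card {p : Fin m × Fin m |
      (p.1 < p.2 ∧ (keyCompletion H key).Adj p.1 p.2) ∧ p ∈ S})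
    (s := (instr (.const 17 0)).sem s) ?_ (by rw [sem_reg rfl]; exact hs.1.1.1)
    ⟨hs.sem rfl rfl rfl rfl, by simp [Code.sem, Instr.apply]⟩ ?_
  · simpa [edgeCount, Code.sem] using h.2
  · rintro S s r x (rfl | rfl) ⟨h, h'⟩ <;>
      exact ⟨h.set (by decide), by rw [State.set_reg_of_ne (by decide), h']⟩
  · rintro x y S s hxy hx hy ⟨h, h'⟩
    refine ⟨h.sem rfl rfl rfl rfl, ?_⟩
    rw [sem_countEdge h hx hy, h']
    split_ifs with hadj
    · rw [← Finset.card_insert_of_notMem (a := (x, y)) (by simp [hxy])]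
      congr 1
      ext ⟨a, b⟩
      simp only [Finset.mem_insert, Finset.mem_filter, Finset.mem_univ, true_and,
        Set.mem_insert_iff, Prod.mk.injEq]
      constructor
      · rintro (⟨rfl, rfl⟩ | h)
        · exact ⟨hadj, .inl ⟨rfl, rfl⟩⟩
        · exact ⟨h.1, .inr h.2⟩
      · tauto
    · rw [add_zero]
      congr 1
      ext ⟨a, b⟩
      simp only [Finset.mem_filter, Finset.mem_univ, true_and, Set.mem_insert_iff, Prod.mk.injEq]
      constructor
      · tauto
      · rintro ⟨h, ⟨rfl, rfl⟩ | h'⟩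
        · exact absurd h hadj
        · exact ⟨h, h'⟩

open Classical in
theorem sem_writeEntry (hs : HasLows H key s) {x y : Fin m} (hx : s.reg 15 = x)
    (hy : s.reg 16 = y) :
    (writeEntry.sem s).mem 1 = Function.update (s.mem 1) (x.val * m + y.val)
      (if (keyCompletion H key).Adj x y then 1 else 0) := by
  have hsep := sem_separate hs (by decide) (by decide) hx hy
  have hm : ((separate 15 16).sem s).mem 1 = s.mem 1 := sem_mem rfl s
  have g₀ : ((separate 15 16).sem s).reg 0 = m := (hs.sem rfl rfl rfl rfl).1.1.1
  have gx : ((separate 15 16).sem s).reg 15 = x := by rw [sem_reg rfl, hx]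
  have gy : ((separate 15 16).sem s).reg 16 = y := by rw [sem_reg rfl, hy]
  rw [writeEntry, Code.sem]
  generalize (separate 15 16).sem s = t at *
  have g₅ : ((Code.cond 9 (instr (.const 5 0)) (instr (.const 5 1))).sem t).reg 5 =
      if (keyCompletion H key).Adj x y then 1 else 0 := by
    rw [Code.sem]
    by_cases hK : (keyCompletion H key).Adj x y
    · rw [if_neg (not_not.2 (hsep.2 hK)), if_pos hK]
      rfl
    · rw [if_pos (mt hsep.1 hK), if_neg hK]
      rfl
  have hm' : ((Code.cond 9 (instr (.const 5 0)) (instr (.const 5 1))).sem t).mem 1 = s.mem 1 := by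
    rw [sem_mem rfl, hm]
  have g₀' : ((Code.cond 9 (instr (.const 5 0)) (instr (.const 5 1))).sem t).reg 0 = m := by
    rw [sem_reg rfl, g₀]
  have gx' : ((Code.cond 9 (instr (.const 5 0)) (instr (.const 5 1))).sem t).reg 15 = x := by
    rw [sem_reg rfl, gx]
  have gy' : ((Code.cond 9 (instr (.const 5 0)) (instr (.const 5 1))).sem t).reg 16 = y := by
    rw [sem_reg rfl, gy]
  rw [Code.sem]
  generalize (Code.cond 9 (instr (.const 5 0)) (instr (.const 5 1))).sem t = t' at *
  change Function.update ((index 15 16).sem t').mem 1 (Function.update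
    (((index 15 16).sem t').mem 1) (((index 15 16).sem t').reg 4)
    (((index 15 16).sem t').reg 5)) 1 = _
  rw [Function.update_self, sem_mem rfl, sem_reg (r := 5) rfl,
    sem_index (by decide) (by decide) (by decide) (by decide), g₅, hm', g₀', gx', gy']

open Classical in
theorem sem_writeMatrix (hs : HasLows H key s) (i j : Fin m) :
    (writeMatrix.sem s).mem 1 (i.val * m + j.val) =
      if (keyCompletion H key).Adj i j then 1 else 0 := by
  have h := sem_count_count_induction (i := 15) (j := 16) (p := writeEntry) (by decide) (by decide)
    (by decide) rfl rfl
    (fun S s' => HasLows H key s' ∧ ∀ p ∈ S, s'.mem 1 (p.1.val * m + p.2.val) =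
      if (keyCompletion H key).Adj p.1 p.2 then 1 else 0)
    (s := s) ?_ hs.1.1.1 ⟨hs, by simp⟩ ?_
  · exact h.2 (i, j) trivial
  · rintro S s r x (rfl | rfl) ⟨h, h'⟩ <;> exact ⟨h.set (by decide), h'⟩
  · rintro x y S s - hx hy ⟨h, h'⟩
    refine ⟨h.sem rfl rfl rfl rfl, ?_⟩
    rintro ⟨a, b⟩ hab
    rw [sem_writeEntry h hx hy]
    by_cases e : a = x ∧ b = y
    · obtain ⟨rfl, rfl⟩ := e
      exact Function.update_self _ _ _
    · rw [Function.update_of_ne (mt index_inj.1 e)]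
      refine h' _ (hab.resolve_left ?_)
      simpa using e

/-! ### Correctness: the search over all tuples -/

variable {c₁ c₂ c₃ b b' : Fin m}

/-- No output yet, or the output is one of the completions that the search goes through. -/
def Found (H : SimpleGraph (Fin m)) (s : State) : Prop :=
  s.reg 1 = m * m ∨ ∃ c₁ c₂ c₃ b b', OutputsGraph s (keyCompletion H (tupleKey H c₁ c₂ c₃ b b'))

theorem Found.congr {s' : State} (h : Found H s) (h₁ : s'.reg 1 = s.reg 1)
    (h₂ : s'.mem 1 = s.mem 1) : Found H s' := by
  simpa only [Found, OutputsGraph, h₁, h₂] using h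

/-- Output is rewritten, count and matrix together, only for a strict improvement; otherwise
register `1` and bank `1` are untouched and the earlier output remains valid. -/
theorem sem_tryTuple (hs : Ready H c₁ c₂ c₃ b b' s) (hF : Found H s) :
    Found H (tryTuple.sem s) ∧ (tryTuple.sem s).reg 1 ≤ s.reg 1 ∧ (tryTuple.sem s).reg 1 ≤
      (keyCompletion H (tupleKey H c₁ c₂ c₃ b b')).edgeSet.ncard := by
  have h₁ : HasKeys H (tupleKey H c₁ c₂ c₃ b b') (keys.sem s) :=
    ⟨hs.1.sem rfl rfl, sem_keys hs⟩
  have h₂ := sem_lows h₁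
  have h₃ := h₂.sem (p := edgeCount) rfl rfl rfl rfl
  have h₁₇ := sem_edgeCount h₂
  have r₁ : (edgeCount.sem (lows.sem (keys.sem s))).reg 1 = s.reg 1 := by
    rw [sem_reg rfl, sem_reg rfl, sem_reg rfl]
  have m₁ : (edgeCount.sem (lows.sem (keys.sem s))).mem 1 = s.mem 1 := by
    rw [sem_mem rfl, sem_mem rfl, sem_mem rfl]
  rw [tryTuple, Code.sem, Code.sem, Code.sem]
  generalize edgeCount.sem (lows.sem (keys.sem s)) = t at *
  have g₃ := h₃.sem (p := instr (.sub 5 1 17)) rfl rfl rfl rfl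
  have g₁₇ : ((instr (.sub 5 1 17)).sem t).reg 17 = t.reg 17 := sem_reg rfl t
  have q₁ : ((instr (.sub 5 1 17)).sem t).reg 1 = s.reg 1 := by rw [sem_reg rfl, r₁]
  have n₁ : ((instr (.sub 5 1 17)).sem t).mem 1 = s.mem 1 := by rw [sem_mem rfl, m₁]
  have q₅ : ((instr (.sub 5 1 17)).sem t).reg 5 = s.reg 1 - t.reg 17 := by
    rw [← r₁]
    rfl
  rw [Code.sem]
  generalize (instr (.sub 5 1 17)).sem t = t' at *
  rw [h₁₇] at *
  rw [Code.sem]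
  split_ifs with h
  · have e : ∃ t'', (instr (.const 1 0) ;; instr (.add 1 1 17) ;; writeMatrix).sem t' =
        writeMatrix.sem t'' ∧ t''.reg 1 = t'.reg 17 ∧
        HasLows H (tupleKey H c₁ c₂ c₃ b b') t'' :=
      ⟨_, rfl, by simp [Code.sem, Instr.apply], g₃.sem (p := instr (.const 1 0) ;; instr (.add 1 1 17))
        rfl rfl rfl rfl⟩
    obtain ⟨t'', e, e₁, h''⟩ := e
    rw [e]
    have f₁ : (writeMatrix.sem t'').reg 1 =
        (keyCompletion H (tupleKey H c₁ c₂ c₃ b b')).edgeSet.ncard := by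
      rw [sem_reg rfl, e₁, g₁₇]
    exact ⟨.inr ⟨c₁, c₂, c₃, b, b', f₁, fun i j => by rw [sem_writeMatrix h'']⟩, by omega, f₁.le⟩
  · rw [Code.sem]
    exact ⟨hF.congr q₁ n₁, q₁.le, by omega⟩

/-- A loop over all vertices whose body does not increase the value of register `1`, keeps an
invariant `J`, and for the vertex `k` brings the value of register `1` below a bound. -/
theorem sem_count_search {i : ℕ} {p : Code} (hi : i ≠ 1) {J : State → Prop}
    {B : Fin m → ℕ → Prop} (hB : ∀ k x y, x ≤ y → B k y → B k x) (h₀ : s.reg 0 = m)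
    (hset : ∀ s x, J s → J (s.set i x)) (hJ : J s)
    (step : ∀ (k : Fin m) s, J s → s.reg i = k →
      J (p.sem s) ∧ (p.sem s).reg 1 ≤ s.reg 1 ∧ B k ((p.sem s).reg 1)) :
    J ((count i p).sem s) ∧ ((count i p).sem s).reg 1 ≤ s.reg 1 ∧
      ∀ k, B k (((count i p).sem s).reg 1) := by
  have h := sem_count_induction (i := i) (p := p)
    (fun k s' => J s' ∧ s'.reg 1 ≤ s.reg 1 ∧ ∀ l : Fin m, k ≤ l → B l (s'.reg 1)) (s := s)
    ⟨hset _ _ hJ, by rw [State.set_reg_of_ne hi.symm], fun l hl => by rw [h₀] at hl; omega⟩ ?_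
  · exact ⟨h.1, h.2.1, fun k => h.2.2 k (Nat.zero_le _)⟩
  · rintro k s' hk ⟨h₁, h₂, h₃⟩
    rw [h₀] at hk
    obtain ⟨g₁, g₂, g₃⟩ := step ⟨k, hk⟩ (s'.set i k) (hset _ _ h₁) State.set_reg_self
    rw [State.set_reg_of_ne hi.symm] at g₂
    refine ⟨g₁, g₂.trans h₂, fun l hl => ?_⟩
    rcases eq_or_lt_of_le hl with h | h
    · have : l = ⟨k, hk⟩ := Fin.ext h.symm
      subst this
      exact g₃
    · exact hB _ _ _ g₂ (h₃ l h)

theorem Found.set (h : Found H s) {i x : ℕ} (hi : i ≠ 1) : Found H (s.set i x) :=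
  h.congr (State.set_reg_of_ne hi.symm) rfl

/-- `sem_count_search` is applied to five nested loops: the invariant `J` remembers the coordinates
already fixed, and the bound `B` quantifies over those of the inner loops. -/
theorem sem_search (hs : Input H s) :
    Found H (search.sem s) ∧ ∀ c₁ c₂ c₃ b b', (search.sem s).reg 1 ≤
      (keyCompletion H (tupleKey H c₁ c₂ c₃ b b')).edgeSet.ncard := by
  have e : ∃ t, search.sem s =
      (count 10 (count 11 (count 12 (count 13 (count 14 tryTuple))))).sem t ∧
      Input H t ∧ t.reg 1 = m * m := by
    refine ⟨_, rfl, hs.sem (p := instr (.const 18 0) ;; index 0 18 ;; instr (.const 1 0) ;;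
      instr (.add 1 1 4)) rfl rfl, ?_⟩
    have h := sem_index (w := 0) (v := 18) (by decide) (by decide) (by decide) (by decide)
      ((instr (.const 18 0)).sem s)
    have h₀ : ((instr (.const 18 0)).sem s).reg 0 = m := by rw [sem_reg rfl, hs.1]
    have h₁₈ : ((instr (.const 18 0)).sem s).reg 18 = 0 := by simp [Code.sem, Instr.apply]
    rw [h₀, h₁₈, add_zero] at h
    generalize (instr (.const 18 0)).sem s = s' at *
    rw [← h]
    simp [Code.sem, Instr.apply]
  obtain ⟨t, e, ht, h₁⟩ := e
  rw [e]
  clear e hs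
  have main := sem_count_search (i := 10) (s := t)
    (p := count 11 (count 12 (count 13 (count 14 tryTuple)))) (by decide)
    (J := fun s => Input H s ∧ Found H s)
    (B := fun c₁ x => ∀ c₂ c₃ b b', x ≤
      (keyCompletion H (tupleKey H c₁ c₂ c₃ b b')).edgeSet.ncard)
    (fun _ _ _ h h' c₂ c₃ b b' => h.trans (h' c₂ c₃ b b')) ht.1
    (fun s x h => ⟨h.1.set (by decide), h.2.set (by decide)⟩) ⟨ht, .inl h₁⟩ ?_
  · exact ⟨main.1.2, main.2.2⟩
  rintro c₁ s ⟨hs, hF⟩ hc₁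
  have main := sem_count_search (i := 11) (s := s)
    (p := count 12 (count 13 (count 14 tryTuple))) (by decide)
    (J := fun s => Input H s ∧ Found H s ∧ s.reg 10 = c₁)
    (B := fun c₂ x => ∀ c₃ b b', x ≤
      (keyCompletion H (tupleKey H c₁ c₂ c₃ b b')).edgeSet.ncard)
    (fun _ _ _ h h' c₃ b b' => h.trans (h' c₃ b b')) hs.1
    (fun s x h => ⟨h.1.set (by decide), h.2.1.set (by decide), h.2.2⟩) ⟨hs, hF, hc₁⟩ ?_
  · exact ⟨⟨main.1.1, main.1.2.1⟩, main.2⟩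
  clear hs hF hc₁ s
  rintro c₂ s ⟨hs, hF, hc₁⟩ hc₂
  have main := sem_count_search (i := 12) (s := s)
    (p := count 13 (count 14 tryTuple)) (by decide)
    (J := fun s => Input H s ∧ Found H s ∧ s.reg 10 = c₁ ∧ s.reg 11 = c₂)
    (B := fun c₃ x => ∀ b b', x ≤
      (keyCompletion H (tupleKey H c₁ c₂ c₃ b b')).edgeSet.ncard)
    (fun _ _ _ h h' b b' => h.trans (h' b b')) hs.1
    (fun s x h => ⟨h.1.set (by decide), h.2.1.set (by decide), h.2.2⟩) ⟨hs, hF, hc₁, hc₂⟩ ?_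
  · exact ⟨⟨main.1.1, main.1.2.1, main.1.2.2.1⟩, main.2⟩
  clear hs hF hc₁ hc₂ s
  rintro c₃ s ⟨hs, hF, hc₁, hc₂⟩ hc₃
  have main := sem_count_search (i := 13) (s := s)
    (p := count 14 tryTuple) (by decide)
    (J := fun s => Input H s ∧ Found H s ∧ s.reg 10 = c₁ ∧ s.reg 11 = c₂ ∧ s.reg 12 = c₃)
    (B := fun b x => ∀ b', x ≤
      (keyCompletion H (tupleKey H c₁ c₂ c₃ b b')).edgeSet.ncard)
    (fun _ _ _ h h' b' => h.trans (h' b')) hs.1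
    (fun s x h => ⟨h.1.set (by decide), h.2.1.set (by decide), h.2.2⟩) ⟨hs, hF, hc₁, hc₂, hc₃⟩ ?_
  · exact ⟨⟨main.1.1, main.1.2.1, main.1.2.2.1, main.1.2.2.2.1⟩, main.2⟩
  clear hs hF hc₁ hc₂ hc₃ s
  rintro b s ⟨hs, hF, hc₁, hc₂, hc₃⟩ hb
  have main := sem_count_search (i := 14) (s := s) (p := tryTuple) (by decide)
    (J := fun s => Input H s ∧ Found H s ∧ s.reg 10 = c₁ ∧ s.reg 11 = c₂ ∧ s.reg 12 = c₃ ∧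
      s.reg 13 = b)
    (B := fun b' x => x ≤ (keyCompletion H (tupleKey H c₁ c₂ c₃ b b')).edgeSet.ncard)
    (fun _ _ _ h h' => h.trans h') hs.1
    (fun s x h => ⟨h.1.set (by decide), h.2.1.set (by decide), h.2.2⟩)
    ⟨hs, hF, hc₁, hc₂, hc₃, hb⟩ ?_
  · exact ⟨⟨main.1.1, main.1.2.1, main.1.2.2.1, main.1.2.2.2.1, main.1.2.2.2.2.1⟩, main.2⟩
  clear hs hF hc₁ hc₂ hc₃ hb s
  rintro b' s ⟨hs, hF, hc₁, hc₂, hc₃, hb⟩ hb'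
  have hR : Ready H c₁ c₂ c₃ b b' s := ⟨hs, hc₁, hc₂, hc₃, hb, hb'⟩
  obtain ⟨f₁, f₂, f₃⟩ := sem_tryTuple hR hF
  obtain ⟨g, g₁, g₂, g₃, g₄, -⟩ := hR.sem (p := tryTuple) (by decide) (by decide)
  exact ⟨⟨g, f₁, g₁, g₂, g₃, g₄⟩, f₂, f₃⟩

end

end RandomAccess

/-! ### Conclusion -/

/-- The strict inequality shows that the initial value `m * m` of the output register is always
beaten by the first tuple. -/
theorem ncard_edgeSet_lt_mul {m : ℕ} (hm : 0 < m) (K : SimpleGraph (Fin m)) :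
    K.edgeSet.ncard < m * m := by
  classical
  rw [SimpleGraph.ncard_edgeSet_eq_card_lt]
  calc _ < (Finset.univ : Finset (Fin m × Fin m)).card := by
        refine Finset.card_lt_card (Finset.filter_ssubset.2 ⟨(⟨0, hm⟩, ⟨0, hm⟩), ?_⟩)
        simp
    _ = m * m := by simp

theorem isMinimumIntervalCompletion_keyCompletion {m : ℕ} (hm : 0 < m) {H : SimpleGraph (Fin m)}
    (hH : CommonNeighborsClique Hᶜ) {key : Fin m → ℕ}
    (hmin : ∀ c₁ c₂ c₃ b b', (keyCompletion H key).edgeSet.ncard ≤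
      (keyCompletion H (tupleKey H c₁ c₂ c₃ b b')).edgeSet.ncard) :
    IsMinimumIntervalCompletion H (keyCompletion H key) := by
  refine ⟨isIntervalCompletion_keyCompletion H key, fun K hK => ?_⟩
  obtain ⟨c₁, c₂, c₃, b, b', h⟩ := exists_keyCompletion_le hm hH hK
  exact (hmin c₁ c₂ c₃ b b').trans
    (Set.ncard_le_ncard (SimpleGraph.edgeSet_subset_edgeSet.2 h) (Set.toFinite _))

open RandomAccess Code in
theorem exists_outputsGraph_search {m : ℕ} {H : SimpleGraph (Fin m)} (hH : IsCoLineGraph H)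
    {s : State} (hs : Input H s) :
    ∃ K, OutputsGraph (search.sem s) K ∧ IsMinimumIntervalCompletion H K := by
  obtain ⟨found, le⟩ := sem_search hs
  -- Without vertices there is no tuple, but the initial value `0 * 0` is the correct edge count.
  rcases Nat.eq_zero_or_pos m with rfl | hm
  · refine ⟨⊥, ⟨?_, fun i => i.elim0⟩, ⟨fun i => i.elim0, ?_⟩, by simp⟩
    · rcases found with h | ⟨c, -⟩
      · simpa using h
      · exact c.elim0
    · exact ⟨0, 0, fun i => i.elim0, fun i => i.elim0⟩
  · rcases found with h | ⟨c₁, c₂, c₃, b, b', h⟩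
    · have := (le ⟨0, hm⟩ ⟨0, hm⟩ ⟨0, hm⟩ ⟨0, hm⟩ ⟨0, hm⟩).trans_lt (ncard_edgeSet_lt_mul hm _)
      exact absurd h this.ne
    · refine ⟨_, h, isMinimumIntervalCompletion_keyCompletion hm hH.commonNeighborsClique_compl ?_⟩
      rw [← h.1]
      exact le

theorem mainTheorem4 :
    ∃ (P : RandomAccess.Program) (T : Polynomial ℕ),
      ∀ (m : ℕ) (H : SimpleGraph (Fin m)), IsCoLineGraph H →
        ∃ (t : ℕ) (s : RandomAccess.State) (K : SimpleGraph (Fin m)),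
          RandomAccess.Run P (RandomAccess.inputGraph H) t s ∧
          t ≤ T.eval m ∧
          RandomAccess.OutputsGraph s K ∧
          IsMinimumIntervalCompletion H K := by
  -- The compiled loops need the constant `1` in register `2`; setting it accounts for the summand
  -- `1` in the time bound.
  refine ⟨.seq (.instr (.const 2 1)) RandomAccess.Code.search.compile,
    1 + RandomAccess.Code.search.cost, fun m H hH => ?_⟩
  obtain ⟨t, ht, run⟩ := RandomAccess.Code.run_compile (p := .search)
    (s := RandomAccess.Instr.apply (.const 2 1) (RandomAccess.inputGraph H)) rfl rfl rfl
    rfl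
  obtain ⟨K, out, hK⟩ := exists_outputsGraph_search hH
    (s := RandomAccess.Instr.apply (.const 2 1) (RandomAccess.inputGraph H)) ⟨rfl, rfl⟩
  refine ⟨_, _, K, .seq (.instr _ _) run, ?_, out, hK⟩
  rw [Polynomial.eval_add, Polynomial.eval_one]
  exact Nat.add_le_add_left ht 1
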